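/- Let $f:\mathbb R^p\to\mathbb R$ have a global maximum at $x^*$, let $f$ be twice continuously differentiable near $x^*$, and let $D_G^2:=-\nabla^2 f(x^*)$ be positive definite. Let $D_V$ be a symmetric $p\times p$ matrix with $D_V^2\le D_G^2$ such that the function $$u\mapsto f(x^*+u)+\tfrac12\|D_Gu\|^2-\tfrac12\|D_Vu\|^2$$ is concave on $\mathbb R^p$. Fix $0<\nu<1$ and $\mathtt x>0$, and put $$p_G=\operatorname{tr}(D_V^2D_G^{-2}),\qquad r_G=2\sqrt{p_G}+\sqrt{2\mathtt x},\qquad \mathcal U=\{u:\|D_Vu\|\le\nu^{-1}r_G\},$$ $$\delta_3(u)=f(x^*+u)-f(x^*)-\langle\nabla f(x^*),u\rangle-\tfrac12\langle\nabla^2f(x^*)u,u\rangle,\qquad \omega=\sup_{u\in\mathcal U}\frac{|\delta_3(u)|}{\|D_Vu\|^2/2},$$ where $0/0=0$ and $a/0=\infty$ for $a>0$. Assume $\omega\le 1-\nu$, $\omega\le 1/3$ and $\omega\,p_G\le 2/3$. Then $\int e^{f(x)}\,dx<\infty$, so that the density proportional to $e^{f}$ defines a probability measure $\mathbb P_f$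 on $\mathbb R^p$. Let $X\sim\mathbb P_f$, $\gamma_G\sim\mathcal N(0,D_G^{-2})$ and $\rho^*=4e^{-\mathtt x-p_G/2}$. For every measurable $g:\mathbb R^p\to\mathbb R$ with $|g|\le1$, $$\bigl|\mathbb E\,g(X-x^*)-\mathbb E\,g(\gamma_G)\bigr|\le 4(\rho^*+\diamondsuit),$$ and, consequently, in total variation distance, $$\sup_{A}\bigl|\mathbb P_f(A)-\mathcal N(x^*,D_G^{-2})(A)\bigr|\le 2(\rho^*+\diamondsuit),$$ where the supremum is over Borel sets $A\subseteq\mathbb R^p$. Both bounds hold * with $\diamondsuit=\dfrac{0.75\,\omega\,p_G}{1-\omega}$; and also * with $\diamondsuit=\diamondsuit_3:=\dfrac{\mathbb E\,\tau_3(\gamma_G)}{4(1-\omega)^{3/2}}$, for every function $\tau_3:\mathbb R^p\to\mathbb R$ such that $\tau_3(su)=s^3\tau_3(u)$ for all $s>0$ and $u\in\mathbb R^p$, $|\delta_3(u)|\le\tau_3(u)/6$ for all $u\in\mathcal U$, and $\tau_3(\gamma_G)$ is integrable. -/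

import Mathlib

open MeasureTheory ProbabilityTheory
open scoped ENNReal Matrix

noncomputable section

namespace Laplace

variable {p : ℕ}

/-- The matrix `-∇²f(x)`, which is `D_G²` when `x` is the mode of `f`. -/
def DG2 (f : EuclideanSpace ℝ (Fin p) → ℝ) (x : EuclideanSpace ℝ (Fin p)) :
    Matrix (Fin p) (Fin p) ℝ :=
  Matrix.of fun i j =>
    -(fderiv ℝ (fderiv ℝ f) x (EuclideanSpace.single i 1) (EuclideanSpace.single j 1))

/-- The quadratic form `⟨A u, u⟩`; in particular `quad D² u = ‖D u‖²` for symmetric `D`. -/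
def quad (A : Matrix (Fin p) (Fin p) ℝ) (u : EuclideanSpace ℝ (Fin p)) : ℝ :=
  inner ℝ (Matrix.toEuclideanLin A u) u

/-- The structural condition on `f` at `x`: `D_V² ≤ D_G² = -∇²f(x)`, and
`u ↦ f(x + u) + ‖D_G u‖² / 2 - ‖D_V u‖² / 2` is concave. -/
structure StructCond (f : EuclideanSpace ℝ (Fin p) → ℝ) (x : EuclideanSpace ℝ (Fin p))
    (DV : Matrix (Fin p) (Fin p) ℝ) : Prop where
  isSymm : DV.IsSymm
  le : (DG2 f x - DV ^ 2).PosSemidef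
  concave : ConcaveOn ℝ Set.univ
    fun u : EuclideanSpace ℝ (Fin p) => f (x + u) + quad (DG2 f x) u / 2 - quad (DV ^ 2) u / 2

/-- The effective dimension `tr(D_V² D_G⁻²)`. -/
def effDim (f : EuclideanSpace ℝ (Fin p) → ℝ) (x : EuclideanSpace ℝ (Fin p))
    (DV : Matrix (Fin p) (Fin p) ℝ) : ℝ :=
  (DV ^ 2 * (DG2 f x)⁻¹).trace

/-- The radius `r_G = 2 √p_G + √(2 t)`. -/
def radius (f : EuclideanSpace ℝ (Fin p) → ℝ) (x : EuclideanSpace ℝ (Fin p))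
    (DV : Matrix (Fin p) (Fin p) ℝ) (t : ℝ) : ℝ :=
  2 * √(effDim f x DV) + √(2 * t)

/-- The local set `{u : ‖D_V u‖ ≤ ν⁻¹ r_G}`. -/
def localSet (f : EuclideanSpace ℝ (Fin p) → ℝ) (x : EuclideanSpace ℝ (Fin p))
    (DV : Matrix (Fin p) (Fin p) ℝ) (ν t : ℝ) : Set (EuclideanSpace ℝ (Fin p)) :=
  {u | ‖Matrix.toEuclideanLin DV u‖ ≤ ν⁻¹ * radius f x DV t}

/-- The third-order Taylor remainder
`δ₃(x, u) = f(x + u) - f(x) - ⟨∇f(x), u⟩ - ⟨∇²f(x) u, u⟩ / 2`. -/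
def delta3 (f : EuclideanSpace ℝ (Fin p) → ℝ) (x u : EuclideanSpace ℝ (Fin p)) : ℝ :=
  f (x + u) - f x - fderiv ℝ f x u + quad (DG2 f x) u / 2

/-- `ω = sup_{u ∈ U} |δ₃(x, u)| / (‖D_V u‖² / 2)` over the local set `U`. In `ℝ≥0∞` one has
`0 / 0 = 0` and `a / 0 = ∞` for `a > 0`, so `ω` is the least `c` with
`|δ₃(x, u)| ≤ c ‖D_V u‖² / 2` on `U`. -/
def omega (f : EuclideanSpace ℝ (Fin p) → ℝ) (x : EuclideanSpace ℝ (Fin p))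
    (DV : Matrix (Fin p) (Fin p) ℝ) (ν t : ℝ) : ℝ≥0∞ :=
  ⨆ u ∈ localSet f x DV ν t,
    ENNReal.ofReal |delta3 f x u| / ENNReal.ofReal (‖Matrix.toEuclideanLin DV u‖ ^ 2 / 2)

/-- The third-order smoothness condition: `τ₃` is homogeneous of degree three, and
`|δ₃(x, u)| ≤ τ₃(u) / 6` on the local set. -/
structure SmoothCond3 (f : EuclideanSpace ℝ (Fin p) → ℝ) (x : EuclideanSpace ℝ (Fin p))
    (DV : Matrix (Fin p) (Fin p) ℝ) (ν t : ℝ) (τ₃ : EuclideanSpace ℝ (Fin p) → ℝ) : Prop where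
  homogeneous : ∀ (s : ℝ) (u : EuclideanSpace ℝ (Fin p)), 0 < s → τ₃ (s • u) = s ^ 3 * τ₃ u
  bound : ∀ u ∈ localSet f x DV ν t, |delta3 f x u| ≤ τ₃ u / 6

/-- The measure with Lebesgue density proportional to `exp f`. -/
def Pf (f : EuclideanSpace ℝ (Fin p) → ℝ) : Measure (EuclideanSpace ℝ (Fin p)) :=
  (volume : Measure (EuclideanSpace ℝ (Fin p))).tilted f

/-- The local error `0.75 ω p_G / (1 - ω)`. -/
def diamond2 (f : EuclideanSpace ℝ (Fin p) → ℝ) (x : EuclideanSpace ℝ (Fin p))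
    (DV : Matrix (Fin p) (Fin p) ℝ) (ν t : ℝ) : ℝ :=
  0.75 * (omega f x DV ν t).toReal * effDim f x DV / (1 - (omega f x DV ν t).toReal)

/-- The local error `E τ₃(γ_G) / (4 (1 - ω)^{3/2})` with `γ_G ∼ N(0, D_G⁻²)`. -/
def diamond3 (f : EuclideanSpace ℝ (Fin p) → ℝ) (x : EuclideanSpace ℝ (Fin p))
    (DV : Matrix (Fin p) (Fin p) ℝ) (ν t : ℝ) (τ₃ : EuclideanSpace ℝ (Fin p) → ℝ) : ℝ :=
  (∫ u, τ₃ u ∂(multivariateGaussian 0 (DG2 f x)⁻¹)) /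
    (4 * (1 - (omega f x DV ν t).toReal) ^ (3 / 2 : ℝ))

/-- The tail error `4 exp(-t - p_G / 2)`. -/
def rhoStar (f : EuclideanSpace ℝ (Fin p) → ℝ) (x : EuclideanSpace ℝ (Fin p))
    (DV : Matrix (Fin p) (Fin p) ℝ) (t : ℝ) : ℝ :=
  4 * Real.exp (-t - effDim f x DV / 2)

end Laplace

end

/-!
Let `T` be a matrix with `Tᵀ D_G² T = 1` and `Tᵀ D_V² T = diag b`. In the coordinates
`u = x* + T x` the Gaussian approximation becomes the standard Gaussian `γ`, the measure `Pf f`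
becomes `γ` tilted by `δ = δ₃ ∘ T`, the effective dimension is `P = ∑ b i` with `0 ≤ b i ≤ 1`, and
the assumptions say that `δ - ⟨diag b x, x⟩ / 2` is concave and that `|δ| ≤ ω N² / 2` wherever
`N(x) = √⟨diag b x, x⟩` is at most `ν⁻¹ r`, with `r = 2 √P + √(2 t)`. The structure
`Laplace.NormalForm` records this, and `Laplace.exists_normalForm` and `Laplace.Pf_eq_map` carry out
the reduction.

*Total variation.* The positive and the negative part of a density ratio minus one have equal mass.
If the normalizing constant `Z` of `exp δ` is at least `1`, the positive part is below
`(exp δ - 1)⁺`, and otherwise the negative part is below `(1 - exp δ)⁺`. So it suffices to bound the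
`γ`-integrals of these two functions, without dividing by `Z`
(`Laplace.abs_integral_tilted_sub_integral_le`). Each splits into a part outside and a part inside
the local set.

*Outside.* Concavity along rays from the origin gives `δ ≤ N² / 2 - r N / 2`
(`Laplace.NormalForm.le_of_lt`). A Chernoff bound for the quadratic form `N²` and the layer cake
formula turn this into a multiple of `exp (-t - P / 2)`
(`Laplace.NormalForm.setLIntegral_compl_le`); when that number is not small, the claim is trivial.

*Inside, in terms of `ω P`.* Both parts are below `exp (ω N² / 2) - 1`, whose integral is at most
`(1 - ω) ^ (-P / 2) - 1` (`Laplace.lintegral_exp_diagQuad_le`).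

*Inside, in terms of `τ₃`.* With `τ = τ₃ / 6 ≥ |δ|`, the bound `exp δ - 1 ≤ 3 τ` serves where
`δ ≤ 1.9`. Where `δ(x)` is larger, consider the points `A x` and `A' x` with `A = 1 - c diag b` and
`A' = 1 - 2 c diag b`. As `A x` is the midpoint of `x` and `A' x`, concavity shows that `|δ|`, hence
`τ`, cannot be small at both `A x` and `A' x` (`Laplace.NormalForm.le_abs_contract`). The density
ratio of the change of variables `A` is exponentially large at `x`, of order `exp (c N²)`, and for
`c² N²` comparable to `δ(x)` it compensates `exp δ(x)`. Taking `c² = ω 2⁻ʲ / 5`, where `j` runs over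
the dyadic sizes of `δ / (ω N²)`, bounds `exp δ - 1` pointwise by `3 τ` plus a series of functions
whose integrals are geometric multiples of `∫ τ dγ`
(`Laplace.NormalForm.setLIntegral_exp_sub_one_le`). The total factor `3 (1 + 3 ω / 2)` is at most
`3 (1 - ω) ^ (-3 / 2)`. Of `τ₃` only the integrability, the bound on the local set, and the
nonnegativity that homogeneity implies are used.
-/

noncomputable section

namespace Laplace

variable {p : ℕ}

/-! ### Elementary exponential inequalities -/

/-- The case `c = 1 / √15` of the comparison in `exp_sub_le_gain`, for `2 ≤ d`; the numerical
constants are rounded versions of the ones that appear there. -/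
lemma exp_sub_le_mul_exp_of_two_le {d : ℝ} (hd : 2 ≤ d) :
    Real.exp d - 1 - 3 * d ≤ 3 / 20 * d * Real.exp (1.349 * d - 0.696) := by
  have h1 : Real.exp (1.349 * d - 0.696) = Real.exp d * Real.exp (0.349 * d - 0.696) := by
    rw [← Real.exp_add]; ring_nf
  have h2 : 1.42 * (0.349 * d - 0.047) ≤ Real.exp (0.349 * d - 0.696) := by
    have h3 : (1.42 : ℝ) ≤ Real.exp 0.351 := by
      have := Real.quadratic_le_exp_of_nonneg (x := 0.351) (by norm_num)
      have := Real.sum_le_exp_of_nonneg (x := 0.351) (by norm_num) 5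
      norm_num [Finset.sum_range_succ, Nat.factorial] at this ⊢
      linarith
    have h4 := Real.add_one_le_exp (0.349 * d - 0.696 - 0.351)
    have h5 : Real.exp (0.349 * d - 0.696) =
        Real.exp 0.351 * Real.exp (0.349 * d - 0.696 - 0.351) := by
      rw [← Real.exp_add]; ring_nf
    rw [h5]
    apply mul_le_mul h3 (by linarith) (by linarith) (by positivity)
  rw [h1]
  have h6 : Real.exp d * (1 + 0.01002 * d - 0.0743 * d ^ 2) ≤ 1 + 3 * d := by
    rcases le_or_gt 3.8 d with h | h
    · have : 1 + 0.01002 * d - 0.0743 * d ^ 2 ≤ 0 := by nlinarith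
      nlinarith [Real.exp_pos d]
    · have h7 : 0.0608 * (3.8 - d) ≤ Real.exp (-d) := by
        have h8 : (0.0608 : ℝ) ≤ Real.exp (-2.8) := by
          rw [Real.exp_neg, le_inv_comm₀ (by norm_num) (Real.exp_pos _)]
          have : Real.exp 2.8 = Real.exp 1 ^ 2 * Real.exp 0.8 := by
            rw [← Real.exp_nat_mul, ← Real.exp_add]; norm_num
          rw [this]
          have h9 : Real.exp 1 ^ 2 ≤ 2.7182818286 ^ 2 :=
            pow_le_pow_left₀ (Real.exp_pos 1).le Real.exp_one_lt_d9.le 2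
          have h10 : Real.exp 0.8 ≤ 2.2257 := by
            have := Real.exp_bound' (x := 0.8) (by norm_num) (by norm_num) (n := 7) (by norm_num)
            norm_num [Finset.sum_range_succ, Nat.factorial] at this ⊢
            linarith
          calc _ ≤ (2.7182818286 : ℝ) ^ 2 * 2.2257 := by gcongr
            _ ≤ _ := by norm_num
        have h9 := Real.add_one_le_exp (2.8 - d)
        have h10 : Real.exp (-d) = Real.exp (-2.8) * Real.exp (2.8 - d) := by
          rw [← Real.exp_add]; ring_nf
        rw [h10]
        apply mul_le_mul h8 (by linarith) (by linarith) (by positivity)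
      have h11 : 1 + 0.01002 * d - 0.0743 * d ^ 2 ≤ (1 + 3 * d) * Real.exp (-d) := by
        have : (1 + 3 * d) * (0.0608 * (3.8 - d)) ≤ (1 + 3 * d) * Real.exp (-d) := by gcongr
        refine le_trans ?_ this
        nlinarith
      calc Real.exp d * (1 + 0.01002 * d - 0.0743 * d ^ 2)
          ≤ Real.exp d * ((1 + 3 * d) * Real.exp (-d)) := by gcongr
        _ = 1 + 3 * d := by rw [Real.exp_neg]; field_simp
  have h12 : 3 / 20 * d * (Real.exp d * (1.42 * (0.349 * d - 0.047))) ≤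
      3 / 20 * d * (Real.exp d * Real.exp (0.349 * d - 0.696)) := by gcongr
  have := Real.exp_pos d
  nlinarith [mul_pos this (by linarith : 0 < d), mul_pos this (by positivity : 0 < d ^ 2)]

/-- The slope `3` absorbs `exp d - 1` up to `d = 1.9`, so that the contraction argument is needed
only for larger `d`. -/
lemma exp_sub_one_sub_three_mul_nonpos {d : ℝ} (h0 : 0 ≤ d) (h1 : d ≤ 1.9) :
    Real.exp d - 1 - 3 * d ≤ 0 := by
  have h2 : Real.exp 1.9 ≤ 6.7 := by
    have h3 : Real.exp 1.9 = Real.exp 1 * Real.exp 0.9 := by rw [← Real.exp_add]; norm_num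
    have h4 : Real.exp 0.9 ≤ 2.46 := by
      have := Real.exp_bound' (x := 0.9) (by norm_num) (by norm_num) (n := 7) (by norm_num)
      norm_num [Finset.sum_range_succ, Nat.factorial] at this ⊢
      linarith
    rw [h3]
    calc _ ≤ (2.7182818286 : ℝ) * 2.46 := by gcongr; exact Real.exp_one_lt_d9.le
      _ ≤ _ := by norm_num
  have h4 : 0 ≤ 1 - d / 1.9 := by rw [sub_nonneg, div_le_one (by norm_num)]; exact h1
  -- The chord of `exp` over `[0, 1.9]` has slope at most `5.7 / 1.9 = 3`.
  have h5 := convexOn_exp.2 (Set.mem_univ (0 : ℝ)) (Set.mem_univ (1.9 : ℝ)) h4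
    (by positivity : 0 ≤ d / 1.9) (by ring)
  simp only [smul_eq_mul, mul_zero, zero_add, Real.exp_zero, mul_one] at h5
  rw [div_mul_cancel₀ _ (by norm_num)] at h5
  have h6 : d / 1.9 * Real.exp 1.9 ≤ d / 1.9 * 6.7 := by gcongr
  have h7 : d / 1.9 * 5.7 = 3 * d := by ring
  linarith

/-- For `S * √15 ≥ 2` the quotient `exp (S * y) / y ^ 2` increases on `[√15, ∞)`. -/
lemma sq_mul_exp_le {S y : ℝ} (hS : 0.5167 ≤ S) (hy : √15 ≤ y) :
    y ^ 2 / 15 * Real.exp (S * √15) ≤ Real.exp (S * y) := by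
  have hs : √15 ^ 2 = 15 := Real.sq_sqrt (by norm_num)
  have hs15 : (3.87298 : ℝ) ≤ √15 := Real.le_sqrt_of_sq_le (by norm_num)
  have h3 : y / √15 ≤ Real.exp (S * (y - √15) / 2) := by
    refine le_trans ?_ (Real.add_one_le_exp _)
    rw [div_le_iff₀ (by positivity)]
    have h1 : 0.5167 * 3.87298 ≤ S * √15 := mul_le_mul hS hs15 (by norm_num) (by linarith)
    have h2 : 0 ≤ (y - √15) * (S * √15 / 2 - 1) :=
      mul_nonneg (by linarith) (by norm_num at h1; linarith)
    linarith
  have h4 : y ^ 2 / 15 ≤ Real.exp (S * (y - √15)) := by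
    calc y ^ 2 / 15 = (y / √15) ^ 2 := by rw [div_pow, hs]
      _ ≤ Real.exp (S * (y - √15) / 2) ^ 2 := by
          have : 0 ≤ y := (Real.sqrt_nonneg _).trans hy
          gcongr
      _ = _ := by rw [← Real.exp_nat_mul]; push_cast; ring_nf
  calc y ^ 2 / 15 * Real.exp (S * √15)
      ≤ Real.exp (S * (y - √15)) * Real.exp (S * √15) := by gcongr
    _ = _ := by rw [← Real.exp_add]; ring_nf

lemma sq_le_exp {x : ℝ} (hx : 0 ≤ x) : 1.69 * x ^ 2 ≤ Real.exp x := by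
  have h3 : 1.3 * x ≤ Real.exp (x / 2) := by
    have := Real.add_one_le_exp (x / 2 - 1)
    rw [Real.exp_sub, le_div_iff₀ (Real.exp_pos _)] at this
    have he : (2.6 : ℝ) ≤ Real.exp 1 := by linarith [Real.exp_one_gt_d9]
    have : x / 2 * 2.6 ≤ x / 2 * Real.exp 1 := by gcongr
    linarith
  calc 1.69 * x ^ 2 = (1.3 * x) ^ 2 := by ring
    _ ≤ Real.exp (x / 2) ^ 2 := by gcongr
    _ = Real.exp x := by rw [← Real.exp_nat_mul]; push_cast; ring_nf

/-- On the cell `2/5 * d ≤ c² M ≤ 4/5 * d`, the gain `exp ((c - c² / 2) M)` obtained by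
contracting a point outweighs both the excess of `exp d - 1` over `3 d` and the loss
`exp (-P c / (1 - c))` from the determinant of the contraction. -/
lemma exp_sub_le_gain {c d M P : ℝ} (hc : 0 < c) (hc1 : 15 * c ^ 2 ≤ 1) (hd : 0 ≤ d)
    (hM1 : 2 / 5 * d ≤ c ^ 2 * M) (hM2 : c ^ 2 * M ≤ 4 / 5 * d)
    (hP : 15 * c ^ 2 * P ≤ 2) :
    Real.exp d - 1 - 3 * d ≤ 15 / 2 * c ^ 2 *
      ((d - c ^ 2 * M) / 2 * Real.exp ((c - c ^ 2 / 2) * M - P * (c / (1 - c)))) := by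
  -- `0.2582` exceeds `1 / √15` slightly.
  have hc2 : c ≤ 0.2582 := by nlinarith
  rcases le_or_gt d 1.9 with h | h
  · refine (exp_sub_one_sub_three_mul_nonpos hd h).trans ?_
    have : 0 ≤ d - c ^ 2 * M := by linarith
    positivity
  -- With `y = 1 / c ≥ √15`, the exponent on the right is at least `S y` plus `k z`, where
  -- `z ∈ [0, 1]` locates `c² M` in its cell. The case `z = 0` turns out to be the worst.
  set y := c⁻¹ with hy
  have hcy : c * y = 1 := mul_inv_cancel₀ hc.ne'
  have hy0 : 0 < y := inv_pos.2 hc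
  have hy1 : √15 ≤ y := by
    rw [Real.sqrt_le_left hy0.le]
    have : c ^ 2 * y ^ 2 = 1 := by rw [← mul_pow, hcy, one_pow]
    have := mul_le_mul_of_nonneg_right hc1 (sq_nonneg y)
    linarith
  have hs15 : (3.87298 : ℝ) ≤ √15 := Real.le_sqrt_of_sq_le (by norm_num)
  have hs15' : √15 ≤ 3.873 := Real.sqrt_le_iff.2 ⟨by norm_num, by norm_num⟩
  have hs : √15 ^ 2 = 15 := Real.sq_sqrt (by norm_num)
  set S := 0.34836 * d - 0.17975 with hS
  set k := 2 / 5 * d * (1 - c / 2) * y with hk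
  obtain ⟨z, hz⟩ : ∃ z, c ^ 2 * M = 2 / 5 * d * (1 + z) :=
    ⟨c ^ 2 * M / (2 / 5 * d) - 1, by field_simp; ring⟩
  have hz0 : 0 ≤ z := by
    rw [hz] at hM1
    exact nonneg_of_mul_nonneg_right (by linarith : 0 ≤ d * z) (by linarith)
  have hz1 : z ≤ 1 := by
    rw [hz] at hM2
    exact le_of_mul_le_mul_left (by linarith : d * z ≤ d * 1) (by linarith)
  have hMk : (c - c ^ 2 / 2) * M = k + k * z := by
    have : (c - c ^ 2 / 2) * M = (c ^ 2 * M) * (1 - c / 2) * y := by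
      rw [show c ^ 2 * M * (1 - c / 2) * y = (c * y) * (c * M * (1 - c / 2)) by ring, hcy]; ring
    rw [this, hz, hk]; ring
  have hk0 : 0.34836 * d * y ≤ k := by
    rw [hk]
    refine mul_le_mul_of_nonneg_right ?_ hy0.le
    have : 0 ≤ d * (0.2582 - c) := mul_nonneg hd (by linarith)
    linarith
  have hk2 : 2 ≤ k := by
    refine le_trans ?_ hk0
    have : 1.9 * 3.87298 ≤ d * y := mul_le_mul h.le (hs15.trans hy1) (by norm_num) hd
    linarith
  clear_value k y
  have hPc : P * (c / (1 - c)) ≤ 0.17975 * y := by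
    have h1 : P * (c / (1 - c)) = (15 * c ^ 2 * P) * (y / (15 * (1 - c))) := by
      have : 1 - c ≠ 0 := by linarith
      rw [hy]; field_simp
    have h2 : y / (15 * (1 - c)) ≤ 0.17975 / 2 * y := by
      rw [div_le_iff₀ (by linarith)]
      have : 0 ≤ y * (0.2582 - c) := mul_nonneg hy0.le (by linarith)
      linarith
    have h3 : 0 ≤ y / (15 * (1 - c)) := div_nonneg hy0.le (by linarith)
    rw [h1]
    calc _ ≤ 2 * (y / (15 * (1 - c))) := by gcongr
      _ ≤ 2 * (0.17975 / 2 * y) := by gcongr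
      _ = _ := by ring
  have hE : (0.3 * d) * Real.exp (S * y) ≤
      (d - c ^ 2 * M) / 2 * Real.exp ((c - c ^ 2 / 2) * M - P * (c / (1 - c))) := by
    have h1 : 0.6 ≤ (0.6 - 0.4 * z) * Real.exp (k * z) := by
      have := Real.add_one_le_exp (k * z)
      have h2 : (0.6 - 0.4 * z) * (k * z + 1) ≤ (0.6 - 0.4 * z) * Real.exp (k * z) := by
        gcongr; linarith
      refine le_trans ?_ h2
      have h3 : 0 ≤ 0.6 * k - 0.4 - 0.4 * k * z := by
        have : 0 ≤ k * (1 - z) := mul_nonneg (by linarith) (by linarith)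
        linarith
      have : 0 ≤ z * (0.6 * k - 0.4 - 0.4 * k * z) := mul_nonneg hz0 h3
      linarith
    have h2 : Real.exp (S * y) * Real.exp (k * z) ≤
        Real.exp ((c - c ^ 2 / 2) * M - P * (c / (1 - c))) := by
      rw [← Real.exp_add, Real.exp_le_exp, hMk, hS]
      linarith
    calc 0.3 * d * Real.exp (S * y)
        ≤ (d / 2 * ((0.6 - 0.4 * z) * Real.exp (k * z))) * Real.exp (S * y) := by
          refine mul_le_mul_of_nonneg_right ?_ (Real.exp_pos _).le
          have := mul_le_mul_of_nonneg_left h1 (by linarith : 0 ≤ d / 2)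
          linarith
      _ = (d - c ^ 2 * M) / 2 * (Real.exp (S * y) * Real.exp (k * z)) := by rw [hz]; ring
      _ ≤ _ := by
          refine mul_le_mul_of_nonneg_left h2 ?_
          linarith
  have hS0 : 0.48 ≤ S := by rw [hS]; linarith
  refine le_trans ?_ (mul_le_mul_of_nonneg_left hE (by positivity : 0 ≤ 15 / 2 * c ^ 2))
  -- For `2 ≤ d` the growth in `y` reduces the claim to `y = √15`; for `1.9 < d < 2` a cruder bound
  -- of `exp d` is enough.
  rcases le_or_gt 2 d with h2 | h2
  · refine (exp_sub_le_mul_exp_of_two_le h2).trans ?_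
    have h4 := sq_mul_exp_le (by rw [hS]; linarith : 0.5167 ≤ S) hy1
    have h5 : Real.exp (1.349 * d - 0.696) ≤ Real.exp (S * √15) := by
      rw [Real.exp_le_exp, hS]
      have : 0.5167 * 3.87298 ≤ (0.34836 * d - 0.17975) * √15 :=
        mul_le_mul (by linarith) hs15 (by norm_num) (by linarith)
      have : d * 3.87298 ≤ d * √15 := by gcongr
      linarith
    calc 3 / 20 * d * Real.exp (1.349 * d - 0.696)
        ≤ 3 / 20 * d * Real.exp (S * √15) := by gcongr
      _ = 9 / 4 * d * c ^ 2 * (y ^ 2 / 15 * Real.exp (S * √15)) := by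
          rw [show 9 / 4 * d * c ^ 2 * (y ^ 2 / 15 * Real.exp (S * √15)) =
            3 / 20 * d * Real.exp (S * √15) * (c * y) ^ 2 by ring, hcy]; ring
      _ ≤ 9 / 4 * d * c ^ 2 * Real.exp (S * y) := by gcongr
      _ = _ := by ring
  · have h4 : 1.69 * S ^ 2 ≤ c ^ 2 * Real.exp (S * y) := by
      calc 1.69 * S ^ 2 = c ^ 2 * (1.69 * (S * y) ^ 2) := by
            rw [show c ^ 2 * (1.69 * (S * y) ^ 2) = 1.69 * S ^ 2 * (c * y) ^ 2 by ring, hcy]; ring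
        _ ≤ _ := by
            gcongr
            exact sq_le_exp (mul_nonneg (by linarith) hy0.le)
    have h5 : Real.exp d ≤ 7.4 := by
      have h6 : Real.exp 1 ^ 2 ≤ 2.7182818286 ^ 2 :=
        pow_le_pow_left₀ (Real.exp_pos 1).le Real.exp_one_lt_d9.le 2
      have h7 : Real.exp d ≤ Real.exp 2 := Real.exp_le_exp.2 h2.le
      have h8 : Real.exp 2 = Real.exp 1 ^ 2 := by rw [← Real.exp_nat_mul]; norm_num
      rw [h8] at h7
      norm_num at h6
      linarith
    have h6 : 1.69 * 0.48 ^ 2 ≤ c ^ 2 * Real.exp (S * y) := by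
      refine le_trans ?_ h4
      gcongr
    have h7 : 15 / 2 * c ^ 2 * (0.3 * d * Real.exp (S * y)) =
        9 / 4 * d * (c ^ 2 * Real.exp (S * y)) := by ring
    rw [h7]
    have h8 : 9 / 4 * 1.9 * (1.69 * 0.48 ^ 2) ≤ 9 / 4 * d * (c ^ 2 * Real.exp (S * y)) := by
      gcongr
    norm_num at h8
    linarith

/-- The second contraction in the midpoint inequality gains at least as much as the first. -/
lemma gain_le_gain_two {c M P : ℝ} (hc : 0 < c) (hc1 : 15 * c ^ 2 ≤ 1)
    (hM : 3 / 4 ≤ c ^ 2 * M) (hP0 : 0 ≤ P) (hP : 15 * c ^ 2 * P ≤ 2) :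
    (c - c ^ 2 / 2) * M - P * (c / (1 - c)) ≤
      (2 * c - (2 * c) ^ 2 / 2) * M - P * (2 * c / (1 - 2 * c)) := by
  have hc2 : c ≤ 0.2582 := by nlinarith
  have h1 : 2 * c / (1 - 2 * c) - c / (1 - c) ≤ 3.4 * c := by
    have h2 : 0 < 1 - 2 * c := by linarith
    have h3 : 0 < 1 - c := by linarith
    rw [div_sub_div _ _ h2.ne' h3.ne', div_le_iff₀ (by positivity)]
    nlinarith [mul_pos hc hc, mul_pos (mul_pos hc hc) hc]
  have h4 : P * (2 * c / (1 - 2 * c)) - P * (c / (1 - c)) ≤ P * (3.4 * c) := by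
    rw [← mul_sub]; gcongr
  have h5 : P * (3.4 * c) ≤ (c - 3 / 2 * c ^ 2) * M := by
    have h6 : c * (P * (3.4 * c)) ≤ c * ((c - 3 / 2 * c ^ 2) * M) := by
      have : c * ((c - 3 / 2 * c ^ 2) * M) = (c ^ 2 * M) * (1 - 3 / 2 * c) := by ring
      rw [this]
      nlinarith
    exact le_of_mul_le_mul_left h6 hc
  nlinarith

/-- This gives the exponent `3 / 2` in the local error: it absorbs the total weight
`∑ j, 3 / 4 * ω * 2⁻ʲ` of the contractions. -/
lemma one_add_le_rpow_neg {ω : ℝ} (h0 : 0 ≤ ω) (h1 : ω < 1) :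
    1 + 3 / 2 * ω ≤ ((1 - ω) ^ (3 / 2 : ℝ))⁻¹ := by
  have h := one_add_mul_self_le_rpow_one_add (s := ω / (1 - ω)) (p := 3 / 2)
    (by have := div_nonneg h0 (sub_nonneg.2 h1.le); linarith) (by norm_num)
  have h2 : 1 + ω / (1 - ω) = (1 - ω)⁻¹ := by
    have : 1 - ω ≠ 0 := by linarith
    field_simp; ring
  rw [h2, Real.inv_rpow (by linarith)] at h
  refine le_trans ?_ h
  have : ω ≤ ω / (1 - ω) := by
    rw [le_div_iff₀ (by linarith)]; nlinarith
  linarith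

/-! ### Standard Gaussian measure and diagonal scalings -/

lemma integrable_exp_neg_norm_sq_div_two :
    Integrable fun x : EuclideanSpace ℝ (Fin p) => Real.exp (-‖x‖ ^ 2 / 2) := by
  have hb : (0 : ℝ) < ((1 / 2 : ℂ)).re := by norm_num
  have h := (GaussianFourier.integrable_cexp_neg_mul_sq_norm_add
    (V := EuclideanSpace ℝ (Fin p)) hb 0 0).re
  refine h.congr (ae_of_all _ fun x => ?_)
  have : (-(1 / 2 : ℂ) * (‖x‖ : ℂ) ^ 2 + 0 * (inner ℝ (0 : EuclideanSpace ℝ (Fin p)) x : ℝ)) =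
      ((-‖x‖ ^ 2 / 2 : ℝ) : ℂ) := by
    push_cast; ring
  simp only [this]
  rw [← Complex.ofReal_exp]
  exact Complex.ofReal_re _

/-- The standard Gaussian measure has Lebesgue density proportional to `exp (-‖x‖² / 2)`. -/
lemma stdGaussian_eq_tilted :
    stdGaussian (EuclideanSpace ℝ (Fin p)) = volume.tilted fun x => -‖x‖ ^ 2 / 2 := by
  set V := EuclideanSpace ℝ (Fin p)
  have hb : (0 : ℝ) < ((1 / 2 : ℂ)).re := by norm_num
  have hint : Integrable fun x : V => Real.exp (-‖x‖ ^ 2 / 2) := integrable_exp_neg_norm_sq_div_two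
  have : IsProbabilityMeasure ((volume : Measure V).tilted fun x => -‖x‖ ^ 2 / 2) :=
    isProbabilityMeasure_tilted hint
  apply Measure.ext_of_charFun
  ext t
  rw [charFun_stdGaussian, charFun_apply, integral_tilted]
  set Z := ∫ x : V, Real.exp (-‖x‖ ^ 2 / 2) with hZ
  have hZ0 : 0 < Z := integral_exp_pos hint
  have h1 := GaussianFourier.integral_cexp_neg_mul_sq_norm_add (V := V) hb Complex.I t
  have h2 := GaussianFourier.integral_cexp_neg_mul_sq_norm (V := V) hb
  have h3 : ∫ v : V, Complex.exp (-(1 / 2 : ℂ) * (‖v‖ : ℂ) ^ 2) = (Z : ℂ) := by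
    rw [hZ, ← integral_complex_ofReal]
    refine integral_congr_ae (ae_of_all _ fun x => ?_)
    simp only [Complex.ofReal_exp]
    push_cast
    ring_nf
  rw [← h2, h3] at h1
  have h4 : ∀ x : V, (Real.exp (-‖x‖ ^ 2 / 2) / Z) • Complex.exp ((inner ℝ x t : ℝ) * Complex.I) =
      (Z : ℂ)⁻¹ * Complex.exp (-(1 / 2 : ℂ) * (‖x‖ : ℂ) ^ 2 + Complex.I * (inner ℝ t x : ℝ)) := by
    intro x
    rw [Complex.real_smul, real_inner_comm, Complex.exp_add]
    push_cast
    ring_nf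
  simp_rw [h4]
  rw [integral_const_mul, h1, ← mul_assoc, inv_mul_cancel₀ (by exact_mod_cast hZ0.ne'), one_mul]
  rw [Complex.I_sq]
  ring_nf

/-- The diagonal linear map `x ↦ (a i * x i)`. -/
def diagScale (a : Fin p → ℝ) : EuclideanSpace ℝ (Fin p) →ₗ[ℝ] EuclideanSpace ℝ (Fin p) :=
  Matrix.toEuclideanLin (Matrix.diagonal a)

@[simp]
lemma diagScale_apply (a : Fin p → ℝ) (x : EuclideanSpace ℝ (Fin p)) (i : Fin p) :
    diagScale a x i = a i * x i := by
  simp [diagScale, Matrix.mulVec_diagonal]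

lemma det_diagScale (a : Fin p → ℝ) : LinearMap.det (diagScale a) = ∏ i, a i := by
  change LinearMap.det (Matrix.toLin (PiLp.basisFun 2 ℝ (Fin p)) (PiLp.basisFun 2 ℝ (Fin p))
    (Matrix.diagonal a)) = _
  rw [LinearMap.det_toLin, Matrix.det_diagonal]

lemma measurableEmbedding_of_det_ne_zero
    {A : EuclideanSpace ℝ (Fin p) →ₗ[ℝ] EuclideanSpace ℝ (Fin p)} (hA : LinearMap.det A ≠ 0) :
    MeasurableEmbedding A :=
  (LinearMap.equivOfDetNeZero A hA).toContinuousLinearEquiv.toHomeomorph.measurableEmbedding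

/-- Change of variables for a diagonal contraction or dilation of the standard Gaussian. -/
lemma lintegral_stdGaussian_diagScale {a : Fin p → ℝ} (ha : ∀ i, 0 < a i)
    (F : EuclideanSpace ℝ (Fin p) → ℝ≥0∞) :
    ∫⁻ x, ENNReal.ofReal ((∏ i, a i) * Real.exp ((‖x‖ ^ 2 - ‖diagScale a x‖ ^ 2) / 2)) *
      F (diagScale a x) ∂(stdGaussian (EuclideanSpace ℝ (Fin p))) =
    ∫⁻ x, F x ∂(stdGaussian (EuclideanSpace ℝ (Fin p))) := by
  have hprod : 0 < ∏ i, a i := Finset.prod_pos fun i _ => ha i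
  have hdet : LinearMap.det (diagScale a) ≠ 0 := by rw [det_diagScale]; exact hprod.ne'
  rw [stdGaussian_eq_tilted, lintegral_tilted, lintegral_tilted]
  set Z := ∫ x : EuclideanSpace ℝ (Fin p), Real.exp (-‖x‖ ^ 2 / 2) with hZ
  have hZ0 : 0 ≤ Z := integral_nonneg fun _ => (Real.exp_pos _).le
  set G : EuclideanSpace ℝ (Fin p) → ℝ≥0∞ := fun x =>
    ENNReal.ofReal (Real.exp (-‖x‖ ^ 2 / 2) / Z) * F x with hG
  have h1 : ∀ x, ENNReal.ofReal (Real.exp (-‖x‖ ^ 2 / 2) / Z) *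
      (ENNReal.ofReal ((∏ i, a i) * Real.exp ((‖x‖ ^ 2 - ‖diagScale a x‖ ^ 2) / 2)) *
        F (diagScale a x)) = ENNReal.ofReal (∏ i, a i) * G (diagScale a x) := by
    intro x
    rw [hG, ← mul_assoc, ← mul_assoc, ← ENNReal.ofReal_mul (by positivity),
      ← ENNReal.ofReal_mul hprod.le]
    congr 2
    have : Real.exp (-‖diagScale a x‖ ^ 2 / 2) =
        Real.exp (-‖x‖ ^ 2 / 2) * Real.exp ((‖x‖ ^ 2 - ‖diagScale a x‖ ^ 2) / 2) := by
      rw [← Real.exp_add]; ring_nf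
    rw [this]; ring
  simp_rw [h1]
  rw [lintegral_const_mul' _ _ ENNReal.ofReal_ne_top,
    ← (measurableEmbedding_of_det_ne_zero hdet).lintegral_map G,
    Measure.map_linearMap_addHaar_eq_smul_addHaar _ hdet, lintegral_smul_measure, det_diagScale,
    smul_eq_mul, ← mul_assoc, ← ENNReal.ofReal_mul hprod.le, abs_of_pos (by positivity),
    mul_inv_cancel₀ hprod.ne', ENNReal.ofReal_one, one_mul]

/-- The diagonal quadratic form `∑ i, b i * x i ^ 2`. -/
def diagQuad (b : Fin p → ℝ) (x : EuclideanSpace ℝ (Fin p)) : ℝ := ∑ i, b i * x i ^ 2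

lemma diagQuad_nonneg {b : Fin p → ℝ} (hb : ∀ i, 0 ≤ b i) (x : EuclideanSpace ℝ (Fin p)) :
    0 ≤ diagQuad b x := Finset.sum_nonneg fun i _ => mul_nonneg (hb i) (sq_nonneg _)

lemma continuous_diagQuad (b : Fin p → ℝ) : Continuous (diagQuad b) := by
  unfold diagQuad; fun_prop

lemma diagQuad_smul (b : Fin p → ℝ) (s : ℝ) (x : EuclideanSpace ℝ (Fin p)) :
    diagQuad b (s • x) = s ^ 2 * diagQuad b x := by
  simp only [diagQuad, Finset.mul_sum, PiLp.smul_apply, smul_eq_mul]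
  exact Finset.sum_congr rfl fun i _ => by ring

lemma norm_sq_sub_norm_diagScale_sq (a : Fin p → ℝ) (x : EuclideanSpace ℝ (Fin p)) :
    ‖x‖ ^ 2 - ‖diagScale a x‖ ^ 2 = ∑ i, (1 - a i ^ 2) * x i ^ 2 := by
  rw [EuclideanSpace.real_norm_sq_eq, EuclideanSpace.real_norm_sq_eq, ← Finset.sum_sub_distrib]
  exact Finset.sum_congr rfl fun i _ => by rw [diagScale_apply]; ring

/-- Bernoulli's inequality in each factor. -/
lemma rpow_sum_le_prod {b : Fin p → ℝ} (hb0 : ∀ i, 0 ≤ b i) (hb1 : ∀ i, b i ≤ 1) {c : ℝ}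
    (hc : c < 1) : (1 - c) ^ (∑ i, b i) ≤ ∏ i, (1 - c * b i) := by
  rw [Real.rpow_sum_of_pos (by linarith)]
  refine Finset.prod_le_prod (fun i _ => Real.rpow_nonneg (by linarith) _) fun i _ => ?_
  have := rpow_one_add_le_one_add_mul_self (s := -c) (by linarith) (hb0 i) (hb1 i)
  calc (1 - c) ^ b i = (1 + -c) ^ b i := by ring_nf
    _ ≤ 1 + b i * -c := this
    _ = 1 - c * b i := by ring

lemma one_sub_mul_pos {b c : ℝ} (hb0 : 0 ≤ b) (hb1 : b ≤ 1) (hc : c < 1) : 0 < 1 - c * b := by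
  rcases le_or_gt c 0 with h | h
  · nlinarith
  · nlinarith

/-- Exponential moments of a Gaussian quadratic form with spectrum in `[0, 1]` and trace `P`. -/
lemma lintegral_exp_diagQuad_le {b : Fin p → ℝ} (hb0 : ∀ i, 0 ≤ b i) (hb1 : ∀ i, b i ≤ 1)
    {μ : ℝ} (hμ : μ < 1) :
    ∫⁻ x, ENNReal.ofReal (Real.exp (μ * diagQuad b x / 2))
      ∂(stdGaussian (EuclideanSpace ℝ (Fin p))) ≤
    ENNReal.ofReal ((1 - μ) ^ (-(∑ i, b i) / 2)) := by
  have hpos : ∀ i, 0 < 1 - μ * b i := fun i => one_sub_mul_pos (hb0 i) (hb1 i) hμ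
  -- Scaling by `a` turns the weight into the Gaussian density itself, so the moment is `1 / ∏ a i`.
  set a : Fin p → ℝ := fun i => √(1 - μ * b i) with ha
  have ha0 : ∀ i, 0 < a i := fun i => Real.sqrt_pos.2 (hpos i)
  have ha2 : ∀ i, a i ^ 2 = 1 - μ * b i := fun i => Real.sq_sqrt (hpos i).le
  have hprod : 0 < ∏ i, a i := Finset.prod_pos fun i _ => ha0 i
  have h1 := lintegral_stdGaussian_diagScale ha0 (fun _ => 1)
  simp only [mul_one, lintegral_const, measure_univ] at h1
  have h2 : ∀ x : EuclideanSpace ℝ (Fin p), (‖x‖ ^ 2 - ‖diagScale a x‖ ^ 2) / 2 =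
      μ * diagQuad b x / 2 := by
    intro x
    rw [norm_sq_sub_norm_diagScale_sq, diagQuad, Finset.mul_sum]
    congr 1
    exact Finset.sum_congr rfl fun i _ => by rw [ha2]; ring
  simp_rw [h2, ENNReal.ofReal_mul hprod.le] at h1
  rw [lintegral_const_mul' _ _ ENNReal.ofReal_ne_top] at h1
  set I := ∫⁻ x, ENNReal.ofReal (Real.exp (μ * diagQuad b x / 2))
      ∂(stdGaussian (EuclideanSpace ℝ (Fin p))) with hI
  have h3 : I = ENNReal.ofReal (∏ i, a i)⁻¹ := by
    rw [ENNReal.ofReal_inv_of_pos hprod]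
    exact ENNReal.eq_inv_of_mul_eq_one_left (by rw [mul_comm]; exact h1)
  rw [h3]
  refine ENNReal.ofReal_le_ofReal ?_
  rw [neg_div, Real.rpow_neg (by linarith)]
  refine inv_anti₀ (Real.rpow_pos_of_pos (by linarith) _) ?_
  have h4 : (∏ i, a i) = √(∏ i, (1 - μ * b i)) := by
    rw [eq_comm, Real.sqrt_eq_iff_mul_self_eq (Finset.prod_nonneg fun i _ => (hpos i).le) hprod.le,
      ← sq, ← Finset.prod_pow]
    exact Finset.prod_congr rfl fun i _ => (ha2 i).symm
  rw [h4, div_eq_mul_one_div, Real.rpow_mul (by linarith), ← Real.sqrt_eq_rpow]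
  exact Real.sqrt_le_sqrt (rpow_sum_le_prod hb0 hb1 hμ)

/-! ### Tails of Gaussian quadratic forms -/

/-- Chernoff bound for the tail of a Gaussian quadratic form beyond `r ≥ 2 √P`, where `P` is
its mean. The exponent is affine in `y` apart from `-y² / 2`. -/
lemma measure_lt_sqrt_diagQuad_le {b : Fin p → ℝ} (hb0 : ∀ i, 0 ≤ b i) (hb1 : ∀ i, b i ≤ 1)
    {P r y : ℝ} (hP : ∑ i, b i = P) (hr0 : 0 < r) (hr : 2 * √P ≤ r) (hy : r ≤ y) :
    stdGaussian (EuclideanSpace ℝ (Fin p)) {x | y < √(diagQuad b x)} ≤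
      ENNReal.ofReal (Real.exp (-y ^ 2 / 2 + √P * r - P / 2 + P / r * (y - r))) := by
  have hP0 : 0 ≤ P := hP ▸ Finset.sum_nonneg fun i _ => hb0 i
  have hy0 : 0 < y := hr0.trans_le hy
  rcases hP0.eq_or_lt with h0 | hPpos
  · have hb : ∀ i, b i = 0 := by
      have := (Finset.sum_eq_zero_iff_of_nonneg fun i _ => hb0 i).1 (hP.trans h0.symm)
      exact fun i => this i (Finset.mem_univ i)
    have : {x : EuclideanSpace ℝ (Fin p) | y < √(diagQuad b x)} = ∅ := by
      ext x
      simp [diagQuad, hb, hy0.le]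
    rw [this, measure_empty]
    exact zero_le
  have hsP : 0 < √P := Real.sqrt_pos.2 hPpos
  have hsq : √P ^ 2 = P := Real.sq_sqrt hP0
  -- The Chernoff parameter is `1 - s`; this `s` agrees with the optimal `P / y ^ 2` at `y = r`.
  set s := P / (r * y) with hs
  have hs0 : 0 < s := by positivity
  have hs1 : s < 1 := by
    rw [hs, div_lt_one (by positivity)]
    nlinarith
  have h1 : ∀ x : EuclideanSpace ℝ (Fin p), x ∈ {x | y < √(diagQuad b x)} →
      1 ≤ ENNReal.ofReal (Real.exp (-(1 - s) * y ^ 2 / 2)) *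
        ENNReal.ofReal (Real.exp ((1 - s) * diagQuad b x / 2)) := by
    intro x hx
    rw [← ENNReal.ofReal_mul (Real.exp_pos _).le, ← Real.exp_add, ENNReal.one_le_ofReal,
      Real.one_le_exp_iff]
    have h2 : y ^ 2 ≤ diagQuad b x := by
      have := (Real.lt_sqrt hy0.le).1 hx
      exact this.le
    nlinarith
  have hmeas : MeasurableSet {x : EuclideanSpace ℝ (Fin p) | y < √(diagQuad b x)} :=
    measurableSet_lt measurable_const (continuous_diagQuad b).measurable.sqrt
  calc stdGaussian (EuclideanSpace ℝ (Fin p)) {x | y < √(diagQuad b x)}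
      = ∫⁻ x in {x | y < √(diagQuad b x)}, 1 ∂(stdGaussian (EuclideanSpace ℝ (Fin p))) := by
        rw [setLIntegral_one]
    _ ≤ ∫⁻ x in {x | y < √(diagQuad b x)}, ENNReal.ofReal (Real.exp (-(1 - s) * y ^ 2 / 2)) *
        ENNReal.ofReal (Real.exp ((1 - s) * diagQuad b x / 2))
          ∂(stdGaussian (EuclideanSpace ℝ (Fin p))) := setLIntegral_mono' hmeas h1
    _ ≤ ∫⁻ x, ENNReal.ofReal (Real.exp (-(1 - s) * y ^ 2 / 2)) *
        ENNReal.ofReal (Real.exp ((1 - s) * diagQuad b x / 2))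
          ∂(stdGaussian (EuclideanSpace ℝ (Fin p))) := setLIntegral_le_lintegral _ _
    _ = ENNReal.ofReal (Real.exp (-(1 - s) * y ^ 2 / 2)) *
        ∫⁻ x, ENNReal.ofReal (Real.exp ((1 - s) * diagQuad b x / 2))
          ∂(stdGaussian (EuclideanSpace ℝ (Fin p))) :=
        lintegral_const_mul' _ _ ENNReal.ofReal_ne_top
    _ ≤ ENNReal.ofReal (Real.exp (-(1 - s) * y ^ 2 / 2)) *
        ENNReal.ofReal ((1 - (1 - s)) ^ (-P / 2)) := by
        gcongr
        rw [← hP]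
        exact lintegral_exp_diagQuad_le hb0 hb1 (by linarith)
    _ ≤ _ := by
        rw [← ENNReal.ofReal_mul (Real.exp_pos _).le, sub_sub_cancel,
          Real.rpow_def_of_pos hs0, ← Real.exp_add]
        refine ENNReal.ofReal_le_ofReal (Real.exp_le_exp.2 ?_)
        have h3 : s⁻¹ = y / r * (r / √P) ^ 2 := by
          rw [div_pow, hsq, hs]; field_simp
        -- Bounding the two logarithms separately makes the estimate affine in `y`.
        have h4 : -Real.log s ≤ (y / r - 1) + 2 * (r / √P - 1) := by
          rw [← Real.log_inv, h3, Real.log_mul (by positivity) (by positivity), Real.log_pow]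
          have := Real.log_le_sub_one_of_pos (show 0 < y / r by positivity)
          have := Real.log_le_sub_one_of_pos (show 0 < r / √P by positivity)
          push_cast
          linarith
        have h5 : P / 2 * -Real.log s ≤ P / 2 * ((y / r - 1) + 2 * (r / √P - 1)) := by gcongr
        have h6 : P * (r / √P) = √P * r := by
          nth_rw 1 [← hsq]; field_simp
        have h7 : s * y ^ 2 = P / r * (y - r) + P := by
          rw [hs]; field_simp; ring
        have h8 : P * (y / r - 1) = P / r * (y - r) := by field_simp
        linarith

lemma lintegral_affine_mul_exp_neg {A κ : ℝ} (hA : 0 ≤ A) (hκ : 0 < κ) :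
    ∫⁻ s in Set.Ioi (0 : ℝ), ENNReal.ofReal ((A + s) * Real.exp (-κ * s)) =
      ENNReal.ofReal (A / κ + 1 / κ ^ 2) := by
  have hd : ∀ s ∈ Set.Ici (0 : ℝ),
      HasDerivAt (fun s => -((A + s) / κ + 1 / κ ^ 2) * Real.exp (-κ * s))
        ((A + s) * Real.exp (-κ * s)) s := by
    intro s _
    have h1 : HasDerivAt (fun s : ℝ => -((A + s) / κ + 1 / κ ^ 2)) (-(1 / κ)) s :=
      ((((hasDerivAt_id s).const_add A).div_const κ).add_const _).neg
    have h2 : HasDerivAt (fun s : ℝ => Real.exp (-κ * s)) (Real.exp (-κ * s) * (-κ * 1)) s :=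
      ((hasDerivAt_id s).const_mul (-κ)).exp
    refine (h1.mul h2).congr_deriv ?_
    field_simp
    ring
  have hlim : Filter.Tendsto (fun s => -((A + s) / κ + 1 / κ ^ 2) * Real.exp (-κ * s))
      Filter.atTop (nhds 0) := by
    have h1 := Real.tendsto_pow_mul_exp_neg_atTop_nhds_zero 1
    have h0 := Real.tendsto_pow_mul_exp_neg_atTop_nhds_zero 0
    have ht : Filter.Tendsto (fun s : ℝ => κ * s) Filter.atTop Filter.atTop :=
      Filter.tendsto_id.const_mul_atTop hκ
    have h2 := ((h0.comp ht).const_mul (-(A / κ + 1 / κ ^ 2))).add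
      ((h1.comp ht).const_mul (-(1 / κ ^ 2)))
    simp only [mul_zero, add_zero] at h2
    refine h2.congr fun s => ?_
    simp only [Function.comp_apply]
    field_simp
    ring
  have hnn : ∀ s ∈ Set.Ioi (0 : ℝ), 0 ≤ (A + s) * Real.exp (-κ * s) := fun s hs =>
    mul_nonneg (add_nonneg hA (le_of_lt hs)) (Real.exp_pos _).le
  have hint := integrableOn_Ioi_deriv_of_nonneg' hd hnn hlim
  rw [← ofReal_integral_eq_lintegral_ofReal hint
    ((ae_restrict_iff' measurableSet_Ioi).2 (ae_of_all _ hnn)),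
    integral_Ioi_of_hasDerivAt_of_nonneg' hd hnn hlim]
  simp

/-- The Gaussian tail integral of `exp (N² / 2 - r N / 2)` over `N > r`, by the layer cake formula
from the tail bound for `N`. -/
lemma setLIntegral_exp_le_of_tail {α : Type*} [MeasurableSpace α] {γ : Measure α} {N : α → ℝ}
    (hN : Measurable N) {r κ E : ℝ} (hr : 0 < r) (hκ : 0 < κ) (hE : 0 ≤ E)
    (htail : ∀ y, r ≤ y → γ {x | y < N x} ≤
      ENNReal.ofReal (Real.exp (-y ^ 2 / 2 + r * y / 2 - κ * (y - r)) * E)) :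
    ∫⁻ x in {x | r < N x}, ENNReal.ofReal (Real.exp (N x ^ 2 / 2 - r * N x / 2)) ∂γ ≤
      ENNReal.ofReal ((1 + (r / 2) / κ + 1 / κ ^ 2) * E) := by
  set g : ℝ → ℝ := fun s => (r / 2 + s) * Real.exp ((s ^ 2 + r * s) / 2) with hg
  have hgc : Continuous g := by fun_prop
  have hder : ∀ u : ℝ, HasDerivAt (fun s : ℝ => Real.exp ((s ^ 2 + r * s) / 2)) (g u) u := by
    intro u
    have h1 : HasDerivAt (fun s : ℝ => (s ^ 2 + r * s) / 2) ((2 * u + r * 1) / 2) u := by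
      have := ((hasDerivAt_pow 2 u).add ((hasDerivAt_id u).const_mul r)).div_const 2
      exact this.congr_deriv (by norm_num)
    exact h1.exp.congr_deriv (by simp only [hg]; ring)
  have hG : ∀ s : ℝ, ∫ u in (0 : ℝ)..s, g u = Real.exp ((s ^ 2 + r * s) / 2) - 1 := by
    intro s
    rw [intervalIntegral.integral_eq_sub_of_hasDerivAt (fun u _ => hder u)
      (hgc.intervalIntegrable _ _)]
    norm_num
  have hmeas : MeasurableSet {x | r < N x} := measurableSet_lt measurable_const hN
  have hlc := lintegral_comp_eq_lintegral_meas_lt_mul γ (f := fun x => max (N x - r) 0) (g := g)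
    (ae_of_all _ fun x => le_max_right _ _) (by fun_prop)
    (fun t _ => hgc.intervalIntegrable _ _)
    ((ae_restrict_iff' measurableSet_Ioi).2 (ae_of_all _ fun s hs =>
      mul_nonneg (add_nonneg (by positivity) (le_of_lt hs)) (Real.exp_pos _).le))
  have h1 : ∀ x ∈ {x | r < N x}, ENNReal.ofReal (Real.exp (N x ^ 2 / 2 - r * N x / 2)) ≤
      1 + ENNReal.ofReal (∫ u in (0 : ℝ)..max (N x - r) 0, g u) := by
    intro x hx
    have hx' : r < N x := hx
    rw [hG, max_eq_left (by linarith), ← ENNReal.ofReal_one, ← ENNReal.ofReal_add zero_le_one]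
    · refine ENNReal.ofReal_le_ofReal (le_of_eq ?_)
      rw [add_sub_cancel]
      congr 1; ring
    · rw [sub_nonneg, Real.one_le_exp_iff]
      have : 0 < N x - r := by linarith
      positivity
  have h2 : γ {x | r < N x} ≤ ENNReal.ofReal E := by
    refine (htail r le_rfl).trans (ENNReal.ofReal_le_ofReal (le_of_eq ?_))
    rw [show -r ^ 2 / 2 + r * r / 2 - κ * (r - r) = 0 by ring, Real.exp_zero, one_mul]
  have h3 : ∀ s ∈ Set.Ioi (0 : ℝ), γ {x | s < max (N x - r) 0} * ENNReal.ofReal (g s) ≤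
      ENNReal.ofReal E * ENNReal.ofReal ((r / 2 + s) * Real.exp (-κ * s)) := by
    intro s hs
    have hs' : 0 < s := hs
    have h4 : {x | s < max (N x - r) 0} = {x | r + s < N x} := by
      ext x
      simp only [Set.mem_ofPred_eq, lt_max_iff, not_lt_of_gt hs', or_false]
      constructor <;> intro h <;> linarith
    rw [h4]
    calc _ ≤ ENNReal.ofReal (Real.exp (-(r + s) ^ 2 / 2 + r * (r + s) / 2 - κ * (r + s - r)) * E) *
        ENNReal.ofReal (g s) := by gcongr; exact htail _ (by linarith)
      _ = _ := by
        rw [← ENNReal.ofReal_mul (by positivity), ← ENNReal.ofReal_mul hE]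
        congr 1
        have : Real.exp (-κ * s) = Real.exp (-(r + s) ^ 2 / 2 + r * (r + s) / 2 - κ * (r + s - r)) *
            Real.exp ((s ^ 2 + r * s) / 2) := by
          rw [← Real.exp_add]; ring_nf
        rw [this]; ring
  calc ∫⁻ x in {x | r < N x}, ENNReal.ofReal (Real.exp (N x ^ 2 / 2 - r * N x / 2)) ∂γ
      ≤ ∫⁻ x in {x | r < N x}, (1 + ENNReal.ofReal (∫ u in (0 : ℝ)..max (N x - r) 0, g u)) ∂γ :=
        setLIntegral_mono' hmeas h1
    _ = γ {x | r < N x} +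
        ∫⁻ x in {x | r < N x}, ENNReal.ofReal (∫ u in (0 : ℝ)..max (N x - r) 0, g u) ∂γ := by
        rw [lintegral_add_left measurable_const, setLIntegral_one]
    _ ≤ ENNReal.ofReal E + ∫⁻ x, ENNReal.ofReal (∫ u in (0 : ℝ)..max (N x - r) 0, g u) ∂γ := by
        exact add_le_add h2 (setLIntegral_le_lintegral _ _)
    _ ≤ ENNReal.ofReal E + ∫⁻ s in Set.Ioi (0 : ℝ), ENNReal.ofReal E *
          ENNReal.ofReal ((r / 2 + s) * Real.exp (-κ * s)) := by
        rw [hlc]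
        gcongr 1
        exact setLIntegral_mono' measurableSet_Ioi h3
    _ = _ := by
        rw [lintegral_const_mul' _ _ ENNReal.ofReal_ne_top,
          lintegral_affine_mul_exp_neg (by positivity) hκ, ← ENNReal.ofReal_mul hE,
          ← ENNReal.ofReal_add hE (by positivity)]
        congr 1; ring

/-! ### Normal form: concavity, tails and exponential moments -/

/-- The local Gaussian perturbation problem in coordinates where `D_G² = 1` and `D_V²` is diagonal
with entries `b i`. Here `δ` is the third-order remainder, `P` the effective dimension, `t` the
tail parameter, and the local set is `{x | √(diagQuad b x) ≤ ν⁻¹ r}`. -/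
structure NormalForm (b : Fin p → ℝ) (P t ν ω : ℝ) (δ : EuclideanSpace ℝ (Fin p) → ℝ) :
    Prop where
  nonneg : ∀ i, 0 ≤ b i
  le_one : ∀ i, b i ≤ 1
  sum_eq : ∑ i, b i = P
  zero : δ 0 = 0
  concave : ConcaveOn ℝ Set.univ fun x => δ x - diagQuad b x / 2
  t_pos : 0 < t
  ν_pos : 0 < ν
  ω_nonneg : 0 ≤ ω
  ω_le : ω ≤ 1 - ν
  ω_le_third : ω ≤ 1 / 3
  ω_mul_le : ω * P ≤ 2 / 3
  abs_le : ∀ x, √(diagQuad b x) ≤ ν⁻¹ * (2 * √P + √(2 * t)) → |δ x| ≤ ω * diagQuad b x / 2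

namespace NormalForm

variable {b : Fin p → ℝ} {P t ν ω : ℝ} {δ : EuclideanSpace ℝ (Fin p) → ℝ}

lemma dim_nonneg (h : NormalForm b P t ν ω δ) : 0 ≤ P :=
  h.sum_eq ▸ Finset.sum_nonneg fun i _ => h.nonneg i

lemma radius_pos (h : NormalForm b P t ν ω δ) : 0 < 2 * √P + √(2 * t) := by
  have := Real.sqrt_pos.2 (mul_pos two_pos h.t_pos)
  positivity

lemma radius_le (h : NormalForm b P t ν ω δ) :
    2 * √P + √(2 * t) ≤ ν⁻¹ * (2 * √P + √(2 * t)) := by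
  have h1 : 1 ≤ ν⁻¹ := (one_le_inv₀ h.ν_pos).2 (by linarith [h.ω_nonneg, h.ω_le])
  nlinarith [h.radius_pos]

lemma continuous (h : NormalForm b P t ν ω δ) : Continuous δ := by
  have h1 := (h.concave.locallyLipschitz).continuous
  have h2 := h1.add ((continuous_diagQuad b).div_const 2)
  exact h2.congr fun x => sub_add_cancel _ _

/-- Outside the local set, concavity along the ray from the origin forces the remainder below
`N² / 2 - r N / 2`. -/
lemma le_of_lt (h : NormalForm b P t ν ω δ) {x : EuclideanSpace ℝ (Fin p)}
    (hx : ν⁻¹ * (2 * √P + √(2 * t)) < √(diagQuad b x)) :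
    δ x ≤ √(diagQuad b x) ^ 2 / 2 - (2 * √P + √(2 * t)) * √(diagQuad b x) / 2 := by
  set r := 2 * √P + √(2 * t) with hr
  set R := ν⁻¹ * r with hR
  have hr0 : 0 < r := h.radius_pos
  have hR0 : 0 < R := mul_pos (inv_pos.2 h.ν_pos) hr0
  set N := √(diagQuad b x) with hN
  have hN0 : 0 < N := hR0.trans hx
  have hNq : N ^ 2 = diagQuad b x := Real.sq_sqrt (diagQuad_nonneg h.nonneg x)
  set s := R / N with hs
  have hs0 : 0 < s := div_pos hR0 hN0
  have hs1 : s ≤ 1 := (div_le_one hN0).2 hx.le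
  -- Concavity is applied at `s • x`, the point where the ray through `x` leaves the local set.
  have h1 := h.concave.2 (Set.mem_univ x) (Set.mem_univ 0) hs0.le (sub_nonneg.2 hs1)
    (add_sub_cancel _ _)
  simp only [smul_zero, add_zero, h.zero, smul_eq_mul] at h1
  have h0 : diagQuad b 0 = 0 := by simp [diagQuad]
  have hq : diagQuad b (s • x) = R ^ 2 := by
    rw [diagQuad_smul, ← hNq, hs]; field_simp
  have h2 := (le_abs_self _).trans (h.abs_le (s • x) (by rw [hq, Real.sqrt_sq hR0.le]))
  rw [h0, hq] at h1
  rw [hq] at h2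
  have h3 : s * (δ x - diagQuad b x / 2) ≤ -(ν * R ^ 2 / 2) := by
    have : ω * R ^ 2 ≤ (1 - ν) * R ^ 2 := by gcongr; exact h.ω_le
    linarith
  have h4 : ν * R ^ 2 / 2 = s * (r * N / 2) := by
    rw [hs, hR]
    have := h.ν_pos
    field_simp
  rw [h4] at h3
  have h5 : s * (δ x - diagQuad b x / 2) ≤ s * (-(r * N / 2)) := by linarith
  have h6 := le_of_mul_le_mul_left h5 hs0
  rw [hNq]; linarith

lemma exp_sq_le (h : NormalForm b P t ν ω δ) :
    Real.exp (-((√P + √(2 * t)) ^ 2 / 2)) ≤ Real.exp (-t - P / 2) := by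
  rw [Real.exp_le_exp]
  have h1 : √P ^ 2 = P := Real.sq_sqrt h.dim_nonneg
  have h2 : √(2 * t) ^ 2 = 2 * t := Real.sq_sqrt (by linarith [h.t_pos])
  nlinarith [mul_nonneg (Real.sqrt_nonneg P) (Real.sqrt_nonneg (2 * t))]

/-- The Chernoff bound at `r = 2 √P + √(2 t)`, with the factor that decays in `y - r` split off in
the form that the layer cake formula needs. -/
lemma tail_le (h : NormalForm b P t ν ω δ) {y : ℝ} (hy : 2 * √P + √(2 * t) ≤ y) :
    stdGaussian (EuclideanSpace ℝ (Fin p)) {x | y < √(diagQuad b x)} ≤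
      ENNReal.ofReal (Real.exp (-y ^ 2 / 2 + (2 * √P + √(2 * t)) * y / 2 -
        ((2 * √P + √(2 * t)) / 2 - P / (2 * √P + √(2 * t))) * (y - (2 * √P + √(2 * t)))) *
          Real.exp (-((√P + √(2 * t)) ^ 2 / 2))) := by
  refine (measure_lt_sqrt_diagQuad_le h.nonneg h.le_one h.sum_eq h.radius_pos
    (by linarith [Real.sqrt_nonneg (2 * t)]) hy).trans (ENNReal.ofReal_le_ofReal (le_of_eq ?_))
  rw [← Real.exp_add]
  have h1 : P = √P ^ 2 := (Real.sq_sqrt h.dim_nonneg).symm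
  congr 1
  generalize hs : √(2 * t) = s
  generalize hu : P / (2 * √P + s) = u
  generalize √P = v at *
  rw [h1]; ring

/-- The Gaussian mass outside the local set. -/
lemma measure_compl_le (h : NormalForm b P t ν ω δ) :
    stdGaussian (EuclideanSpace ℝ (Fin p)) {x | ν⁻¹ * (2 * √P + √(2 * t)) < √(diagQuad b x)} ≤
      ENNReal.ofReal (Real.exp (-t - P / 2)) := by
  refine (measure_mono fun x hx => lt_of_le_of_lt h.radius_le hx).trans
    ((h.tail_le le_rfl).trans (ENNReal.ofReal_le_ofReal ?_))
  refine le_trans (le_of_eq ?_) h.exp_sq_le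
  generalize 2 * √P + √(2 * t) = r
  rw [show -r ^ 2 / 2 + r * r / 2 - (r / 2 - P / r) * (r - r) = 0 by ring, Real.exp_zero, one_mul]

/-- The mass of `exp δ` outside the local set. -/
lemma setLIntegral_compl_le (h : NormalForm b P t ν ω δ) :
    ∫⁻ x in {x | ν⁻¹ * (2 * √P + √(2 * t)) < √(diagQuad b x)}, ENNReal.ofReal (Real.exp (δ x))
      ∂(stdGaussian (EuclideanSpace ℝ (Fin p))) ≤
    ENNReal.ofReal ((3 + 8 / (t + P / 2)) * Real.exp (-t - P / 2)) := by
  have hmeas : ∀ y : ℝ, MeasurableSet {x : EuclideanSpace ℝ (Fin p) | y < √(diagQuad b x)} :=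
    fun y => measurableSet_lt measurable_const (continuous_diagQuad b).measurable.sqrt
  have hP := h.dim_nonneg
  have ht := h.t_pos
  have hr0 := h.radius_pos
  have hs1 : √P ^ 2 = P := Real.sq_sqrt hP
  have hs2 : √(2 * t) ^ 2 = 2 * t := Real.sq_sqrt (by linarith)
  have hr2 : 4 * (t + P / 2) ≤ 2 * (2 * √P + √(2 * t)) ^ 2 := by
    nlinarith [mul_nonneg (Real.sqrt_nonneg P) (Real.sqrt_nonneg (2 * t))]
  have hr4 : 4 * P ≤ (2 * √P + √(2 * t)) ^ 2 := by
    nlinarith [mul_nonneg (Real.sqrt_nonneg P) (Real.sqrt_nonneg (2 * t))]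
  have hexp := h.exp_sq_le
  have htail := fun y => h.tail_le (y := y)
  have hle := fun x => h.le_of_lt (x := x)
  have hrR := h.radius_le
  set r := 2 * √P + √(2 * t) with hr
  set κ := r / 2 - P / r with hκ
  have hκr : r / 4 ≤ κ := by
    have : P / r ≤ r / 4 := by
      rw [div_le_iff₀ hr0]; nlinarith
    linarith
  have hκ0 : 0 < κ := by linarith
  calc ∫⁻ x in {x | ν⁻¹ * r < √(diagQuad b x)}, ENNReal.ofReal (Real.exp (δ x))
        ∂(stdGaussian (EuclideanSpace ℝ (Fin p)))
      ≤ ∫⁻ x in {x | ν⁻¹ * r < √(diagQuad b x)},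
          ENNReal.ofReal (Real.exp (√(diagQuad b x) ^ 2 / 2 - r * √(diagQuad b x) / 2))
        ∂(stdGaussian (EuclideanSpace ℝ (Fin p))) :=
        setLIntegral_mono' (hmeas _) fun x hx =>
          ENNReal.ofReal_le_ofReal (Real.exp_le_exp.2 (hle x hx))
    _ ≤ ∫⁻ x in {x | r < √(diagQuad b x)},
          ENNReal.ofReal (Real.exp (√(diagQuad b x) ^ 2 / 2 - r * √(diagQuad b x) / 2))
        ∂(stdGaussian (EuclideanSpace ℝ (Fin p))) :=
        lintegral_mono_set fun x hx => lt_of_le_of_lt hrR hx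
    _ ≤ ENNReal.ofReal ((1 + (r / 2) / κ + 1 / κ ^ 2) *
          Real.exp (-((√P + √(2 * t)) ^ 2 / 2))) :=
        setLIntegral_exp_le_of_tail (continuous_diagQuad b).measurable.sqrt hr0 hκ0
          (Real.exp_pos _).le htail
    _ ≤ _ := by
        refine ENNReal.ofReal_le_ofReal ?_
        have h1 : (r / 2) / κ ≤ 2 := by
          rw [div_le_iff₀ hκ0]; linarith
        have h2 : 1 / κ ^ 2 ≤ 8 / (t + P / 2) := by
          rw [div_le_div_iff₀ (by positivity) (by positivity)]
          have : (r / 4) ^ 2 ≤ κ ^ 2 := by gcongr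
          nlinarith
        exact mul_le_mul (by linarith) hexp (Real.exp_pos _).le (by positivity)

/-- The local error in terms of the effective dimension. -/
lemma setLIntegral_exp_abs_sub_one_le (h : NormalForm b P t ν ω δ) :
    ∫⁻ x in {x | √(diagQuad b x) ≤ ν⁻¹ * (2 * √P + √(2 * t))},
      ENNReal.ofReal (Real.exp |δ x| - 1) ∂(stdGaussian (EuclideanSpace ℝ (Fin p))) ≤
    ENNReal.ofReal (3 / 2 * (ω * P / (1 - ω))) := by
  have hω := h.ω_nonneg
  have hω3 := h.ω_le_third
  have hP := h.dim_nonneg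
  have hq := fun x => diagQuad_nonneg h.nonneg x
  have h1 : ∫⁻ x in {x | √(diagQuad b x) ≤ ν⁻¹ * (2 * √P + √(2 * t))},
      ENNReal.ofReal (Real.exp |δ x| - 1) ∂(stdGaussian (EuclideanSpace ℝ (Fin p))) ≤
      ∫⁻ x, ENNReal.ofReal (Real.exp (ω * diagQuad b x / 2) - 1)
        ∂(stdGaussian (EuclideanSpace ℝ (Fin p))) := by
    refine le_trans (setLIntegral_mono' ?_ fun x hx => ?_) (setLIntegral_le_lintegral _ _)
    · exact measurableSet_le (continuous_diagQuad b).measurable.sqrt measurable_const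
    · refine ENNReal.ofReal_le_ofReal (sub_le_sub_right (Real.exp_le_exp.2 (h.abs_le x hx)) _)
  have h2 : 1 + ∫⁻ x, ENNReal.ofReal (Real.exp (ω * diagQuad b x / 2) - 1)
      ∂(stdGaussian (EuclideanSpace ℝ (Fin p))) =
      ∫⁻ x, ENNReal.ofReal (Real.exp (ω * diagQuad b x / 2))
        ∂(stdGaussian (EuclideanSpace ℝ (Fin p))) := by
    have : (1 : ℝ≥0∞) = ∫⁻ _, 1 ∂(stdGaussian (EuclideanSpace ℝ (Fin p))) := by simp
    nth_rw 1 [this]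
    rw [← lintegral_add_left measurable_const]
    refine lintegral_congr fun x => ?_
    rw [← ENNReal.ofReal_one, ← ENNReal.ofReal_add zero_le_one, add_sub_cancel]
    rw [sub_nonneg, Real.one_le_exp_iff]
    have := hq x
    positivity
  have h3 := lintegral_exp_diagQuad_le h.nonneg h.le_one (μ := ω) (by linarith)
  rw [← h2, h.sum_eq] at h3
  have h4 : (1 - ω) ^ (-P / 2) ≤ 1 + 3 / 2 * (ω * P / (1 - ω)) := by
    set z := ω * P / (1 - ω) with hz
    have hz0 : 0 ≤ z := by
      have : 0 < 1 - ω := by linarith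
      positivity
    have hz1 : z ≤ 1 := by
      rw [hz, div_le_one (by linarith)]
      linarith [h.ω_mul_le]
    have h5 : (1 - ω) ^ (-P / 2) ≤ Real.exp (z / 2) := by
      rw [Real.rpow_def_of_pos (by linarith), Real.exp_le_exp]
      have h6 := Real.one_sub_inv_le_log_of_pos (x := 1 - ω) (by linarith)
      have h7 : (1 - ω)⁻¹ - 1 = ω / (1 - ω) := by
        have : 1 - ω ≠ 0 := by linarith
        field_simp; ring
      have h8 : -Real.log (1 - ω) ≤ ω / (1 - ω) := by linarith
      have h9 : P / 2 * -Real.log (1 - ω) ≤ P / 2 * (ω / (1 - ω)) := by gcongr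
      have h10 : z / 2 = P / 2 * (ω / (1 - ω)) := by rw [hz]; ring
      linarith
    have h6 := (abs_sub_le_iff.1 (Real.abs_exp_sub_one_sub_id_le (x := z / 2)
      (by rw [abs_of_nonneg (by linarith)]; linarith))).1
    nlinarith
  refine h1.trans ?_
  have h5 := h3.trans (ENNReal.ofReal_le_ofReal h4)
  have h6 : 0 ≤ 3 / 2 * (ω * P / (1 - ω)) := by
    have : 0 < 1 - ω := by linarith
    positivity
  rw [ENNReal.ofReal_add zero_le_one h6, ENNReal.ofReal_one] at h5
  exact (ENNReal.add_le_add_iff_left ENNReal.one_ne_top).1 h5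

end NormalForm

/-! ### Domination along contractions -/

/-- The diagonal contraction `x ↦ ((1 - c * b i) * x i)`, which moves `x` against the gradient of
`diagQuad b`. -/
def contract (b : Fin p → ℝ) (c : ℝ) :
    EuclideanSpace ℝ (Fin p) →ₗ[ℝ] EuclideanSpace ℝ (Fin p) :=
  diagScale fun i => 1 - c * b i

/-- The density ratio `det A * exp ((‖x‖² - ‖A x‖²) / 2)` for `A = contract b c`. -/
def contractWeight (b : Fin p → ℝ) (c : ℝ) (x : EuclideanSpace ℝ (Fin p)) : ℝ :=
  (∏ i, (1 - c * b i)) * Real.exp ((‖x‖ ^ 2 - ‖contract b c x‖ ^ 2) / 2)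

lemma continuous_contract (b : Fin p → ℝ) (c : ℝ) : Continuous (contract b c) :=
  LinearMap.continuous_of_finiteDimensional _

lemma continuous_contractWeight (b : Fin p → ℝ) (c : ℝ) : Continuous (contractWeight b c) := by
  have := continuous_contract b c
  unfold contractWeight
  fun_prop

/-- Weighted Gaussian averages along a contraction do not depend on the contraction. -/
lemma lintegral_contractWeight_mul {b : Fin p → ℝ} (hb0 : ∀ i, 0 ≤ b i) (hb1 : ∀ i, b i ≤ 1)
    {c : ℝ} (hc : c < 1) (F : EuclideanSpace ℝ (Fin p) → ℝ≥0∞) :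
    ∫⁻ x, ENNReal.ofReal (contractWeight b c x) * F (contract b c x)
      ∂(stdGaussian (EuclideanSpace ℝ (Fin p))) =
    ∫⁻ x, F x ∂(stdGaussian (EuclideanSpace ℝ (Fin p))) :=
  lintegral_stdGaussian_diagScale (fun i => one_sub_mul_pos (hb0 i) (hb1 i) hc) F

lemma diagQuad_contract_le {b : Fin p → ℝ} (hb0 : ∀ i, 0 ≤ b i) (hb1 : ∀ i, b i ≤ 1)
    {c : ℝ} (hc0 : 0 ≤ c) (hc : c < 1) (x : EuclideanSpace ℝ (Fin p)) :
    diagQuad b (contract b c x) ≤ diagQuad b x := by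
  refine Finset.sum_le_sum fun i _ => mul_le_mul_of_nonneg_left ?_ (hb0 i)
  rw [contract, diagScale_apply, mul_pow]
  refine mul_le_of_le_one_left (sq_nonneg _) (pow_le_one₀ ?_ ?_)
  · exact (one_sub_mul_pos (hb0 i) (hb1 i) hc).le
  · linarith [mul_nonneg hc0 (hb0 i)]

/-- Lower bound for the density ratio: its exponential factor is large where `diagQuad b x` is, and
the determinant costs at most `exp (-(∑ i, b i) c / (1 - c))`. -/
lemma exp_le_contractWeight {b : Fin p → ℝ} (hb0 : ∀ i, 0 ≤ b i) (hb1 : ∀ i, b i ≤ 1)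
    {c : ℝ} (hc : c < 1) (x : EuclideanSpace ℝ (Fin p)) :
    Real.exp ((c - c ^ 2 / 2) * diagQuad b x - (∑ i, b i) * (c / (1 - c))) ≤
      contractWeight b c x := by
  have h1 : Real.exp (-((∑ i, b i) * (c / (1 - c)))) ≤ ∏ i, (1 - c * b i) := by
    refine le_trans ?_ (rpow_sum_le_prod hb0 hb1 hc)
    rw [Real.rpow_def_of_pos (by linarith), Real.exp_le_exp]
    have h2 := Real.one_sub_inv_le_log_of_pos (x := 1 - c) (by linarith)
    have h3 : 1 - (1 - c)⁻¹ = -(c / (1 - c)) := by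
      have : 1 - c ≠ 0 := by linarith
      field_simp; ring
    rw [h3] at h2
    have h4 : 0 ≤ ∑ i, b i := Finset.sum_nonneg fun i _ => hb0 i
    nlinarith
  have h2 : (c - c ^ 2 / 2) * diagQuad b x ≤ (‖x‖ ^ 2 - ‖contract b c x‖ ^ 2) / 2 := by
    rw [contract, norm_sq_sub_norm_diagScale_sq, diagQuad, Finset.mul_sum, Finset.sum_div]
    refine Finset.sum_le_sum fun i _ => ?_
    have h3 : b i ^ 2 ≤ b i := by nlinarith [hb0 i, hb1 i]
    have h4 : c ^ 2 * b i ^ 2 ≤ c ^ 2 * b i := by gcongr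
    nlinarith [mul_le_mul_of_nonneg_right h4 (sq_nonneg (x i))]
  rw [contractWeight, sub_eq_add_neg, Real.exp_add, mul_comm]
  exact mul_le_mul h1 (Real.exp_le_exp.2 h2) (Real.exp_pos _).le
    ((Real.exp_pos _).le.trans h1)

/-- The contracted points lie on a segment with midpoint `contract b c x`. -/
lemma contract_eq_midpoint (b : Fin p → ℝ) (c : ℝ) (x : EuclideanSpace ℝ (Fin p)) :
    contract b c x = (1 / 2 : ℝ) • x + (1 / 2 : ℝ) • contract b (2 * c) x := by
  ext i
  simp only [contract, diagScale_apply, PiLp.add_apply, PiLp.smul_apply, smul_eq_mul]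
  ring

namespace NormalForm

variable {b : Fin p → ℝ} {P t ν ω : ℝ} {δ : EuclideanSpace ℝ (Fin p) → ℝ}

/-- If the remainder is large at `x`, then it is large in absolute value at one of the contracted
points: `δ - diagQuad b / 2` is concave and `contract b c x` is the midpoint of `x` and
`contract b (2 * c) x`. -/
lemma le_abs_contract (h : NormalForm b P t ν ω δ) {c : ℝ} (x : EuclideanSpace ℝ (Fin p)) :
    (δ x - c ^ 2 * diagQuad b x) / 2 ≤
      |δ (contract b c x)| + |δ (contract b (2 * c) x)| / 2 := by
  have h1 := h.concave.2 (Set.mem_univ x) (Set.mem_univ (contract b (2 * c) x))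
    (by norm_num : (0 : ℝ) ≤ 1 / 2) (by norm_num : (0 : ℝ) ≤ 1 / 2) (by norm_num)
  rw [← contract_eq_midpoint] at h1
  simp only [smul_eq_mul] at h1
  have h2 : diagQuad b x / 4 + diagQuad b (contract b (2 * c) x) / 4 -
      diagQuad b (contract b c x) / 2 ≤ c ^ 2 * diagQuad b x / 2 := by
    simp only [diagQuad, Finset.mul_sum, Finset.sum_div]
    rw [← Finset.sum_add_distrib, ← Finset.sum_sub_distrib]
    refine Finset.sum_le_sum fun i _ => ?_
    simp only [contract, diagScale_apply]
    have h3 : b i ^ 2 ≤ 1 := pow_le_one₀ (h.nonneg i) (h.le_one i)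
    have h4 : b i * b i ^ 2 ≤ b i := mul_le_of_le_one_right (h.nonneg i) h3
    nlinarith [mul_le_mul_of_nonneg_right h4 (sq_nonneg (c * x i))]
  have h5 := le_abs_self (δ (contract b c x))
  have h6 := neg_abs_le (δ (contract b (2 * c) x))
  linarith

/-- Pointwise domination on the local set: for a suitable `c = √(ω / 5 * 2⁻ʲ)`, the excess of
`exp δ - 1` over `3 τ` is at most `15 / 2 * c ^ 2` times a weighted sum of the values of `τ` at two
contracted points. The index `j` is determined by the dyadic size of `δ x / (ω * diagQuad b x)`. -/
lemma exists_contract_bound (h : NormalForm b P t ν ω δ) {τ : EuclideanSpace ℝ (Fin p) → ℝ}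
    (hτ0 : ∀ x, 0 ≤ τ x)
    (hτ : ∀ x, √(diagQuad b x) ≤ ν⁻¹ * (2 * √P + √(2 * t)) → |δ x| ≤ τ x)
    {x : EuclideanSpace ℝ (Fin p)} (hx : √(diagQuad b x) ≤ ν⁻¹ * (2 * √P + √(2 * t))) :
    ∃ j : ℕ, ∀ c, c = √(ω / 5 * (1 / 2) ^ j) →
      Real.exp (δ x) - 1 ≤ 3 * τ x + 15 / 2 * c ^ 2 *
        (contractWeight b c x * τ (contract b c x) +
          contractWeight b (2 * c) x * τ (contract b (2 * c) x) / 2) := by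
  have hδτ := (le_abs_self _).trans (hτ x hx)
  have hω3 := h.ω_le_third
  have hcw : ∀ c, c ≤ 1 / 2 → 0 ≤ contractWeight b c x := fun c hc =>
    (Real.exp_pos _).le.trans (exp_le_contractWeight h.nonneg h.le_one (by linarith) x)
  have hj1 : ∀ j : ℕ, ((1 : ℝ) / 2) ^ j ≤ 1 := fun j => pow_le_one₀ (by norm_num) (by norm_num)
  have hc15 : ∀ (j : ℕ) (c : ℝ), c = √(ω / 5 * (1 / 2) ^ j) → 15 * c ^ 2 = 3 * ω * (1 / 2) ^ j := by
    intro j c hc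
    rw [hc, Real.sq_sqrt (by have := h.ω_nonneg; positivity)]; ring
  have hc15' : ∀ (j : ℕ) (c : ℝ), c = √(ω / 5 * (1 / 2) ^ j) → 15 * c ^ 2 ≤ 1 := by
    intro j c hc
    rw [hc15 j c hc]
    nlinarith [hj1 j, h.ω_nonneg]
  have hc3 : ∀ (j : ℕ) (c : ℝ), c = √(ω / 5 * (1 / 2) ^ j) → c ≤ 1 / 3 := by
    intro j c hc
    nlinarith [hc15' j c hc]
  rcases le_or_gt (δ x) 1.9 with hd | hd
  · refine ⟨0, fun c hc => ?_⟩
    have h1 : Real.exp (δ x) - 1 ≤ 3 * τ x := by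
      rcases le_or_gt 0 (δ x) with h0 | h0
      · linarith [exp_sub_one_sub_three_mul_nonpos h0 hd]
      · have : Real.exp (δ x) ≤ 1 := Real.exp_le_one_iff.2 h0.le
        linarith [hτ0 x]
    have h2 := mul_nonneg (hcw c (by linarith [hc3 0 c hc])) (hτ0 (contract b c x))
    have h3 : 0 ≤ contractWeight b (2 * c) x * τ (contract b (2 * c) x) :=
      mul_nonneg ?_ (hτ0 _)
    · nlinarith [mul_nonneg (sq_nonneg c) h2, mul_nonneg (sq_nonneg c) h3]
    · exact (Real.exp_pos _).le.trans
        (exp_le_contractWeight h.nonneg h.le_one (by linarith [hc3 0 c hc]) x)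
  · have hω0 : 0 < ω := by
      rcases h.ω_nonneg.eq_or_lt with h0 | h0
      · have := (le_abs_self _).trans (h.abs_le x hx)
        rw [← h0] at this
        linarith
      · exact h0
    set M := diagQuad b x with hM
    have hdM := (le_abs_self _).trans (h.abs_le x hx)
    have hM0 : 0 < M := by
      by_contra hcon
      have : ω * M ≤ 0 := mul_nonpos_of_nonneg_of_nonpos hω0.le (not_lt.1 hcon)
      linarith
    -- `2⁻ʲ⁻¹ < 2 δ / (ω M) ≤ 2⁻ʲ` places `c² M = ω M 2⁻ʲ / 5` between `2/5 δ` and `4/5 δ`.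
    obtain ⟨j, hj, hj'⟩ := exists_nat_pow_near_of_lt_one
      (x := 2 * δ x / (ω * M)) (y := 1 / 2) (by have : 0 < δ x := by linarith
                                                positivity)
      (by rw [div_le_one (by positivity)]; linarith) (by norm_num) (by norm_num)
    refine ⟨j, fun c hc => ?_⟩
    have hcpos : 0 < c := by rw [hc]; positivity
    have hc2 : c ^ 2 = ω / 5 * (1 / 2) ^ j := by
      rw [hc, Real.sq_sqrt (by positivity)]
    have hc1 := hc15' j c hc
    have hc13 := hc3 j c hc
    have hM1 : 2 / 5 * δ x ≤ c ^ 2 * M := by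
      rw [div_le_iff₀ (by positivity)] at hj'
      rw [hc2]; linarith
    have hM2 : c ^ 2 * M ≤ 4 / 5 * δ x := by
      rw [lt_div_iff₀ (by positivity), pow_succ] at hj
      rw [hc2]; linarith
    have hP0 := h.dim_nonneg
    have hP : 15 * c ^ 2 * P ≤ 2 := by
      rw [hc15 j c hc]
      have := mul_le_mul_of_nonneg_left (hj1 j) (mul_nonneg hω0.le hP0)
      linarith [h.ω_mul_le]
    have hgain := exp_sub_le_gain hcpos hc1 (by linarith) hM1 hM2 hP
    have hK1 := exp_le_contractWeight h.nonneg h.le_one (c := c) (by linarith) x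
    have hK2 := exp_le_contractWeight h.nonneg h.le_one (c := 2 * c) (by linarith) x
    rw [h.sum_eq, ← hM] at hK1 hK2
    have hK3 := gain_le_gain_two (M := M) hcpos hc1 (by linarith) hP0 hP
    have hK4 := (Real.exp_le_exp.2 hK3).trans hK2
    set K := Real.exp ((c - c ^ 2 / 2) * M - P * (c / (1 - c))) with hK
    have hloc : ∀ c', 0 ≤ c' → c' < 1 → |δ (contract b c' x)| ≤ τ (contract b c' x) :=
      fun c' h0 h1 => hτ _ ((Real.sqrt_le_sqrt
        (diagQuad_contract_le h.nonneg h.le_one h0 h1 x)).trans hx)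
    have hmid := h.le_abs_contract (c := c) x
    have h1 : (δ x - c ^ 2 * M) / 2 * K ≤ contractWeight b c x * τ (contract b c x) +
          contractWeight b (2 * c) x * τ (contract b (2 * c) x) / 2 := by
      have hK0 : 0 < K := Real.exp_pos _
      calc (δ x - c ^ 2 * M) / 2 * K
          ≤ (τ (contract b c x) + τ (contract b (2 * c) x) / 2) * K := by
            gcongr
            have := hloc c hcpos.le (by linarith)
            have := hloc (2 * c) (by linarith) (by linarith)
            linarith
        _ = K * τ (contract b c x) + K * τ (contract b (2 * c) x) / 2 := by ring
        _ ≤ _ := by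
            have := hτ0 (contract b c x)
            have := hτ0 (contract b (2 * c) x)
            gcongr
    have h2 := mul_le_mul_of_nonneg_left h1 (by positivity : 0 ≤ 15 / 2 * c ^ 2)
    linarith

/-- A function that is only a.e. measurable for the Gaussian remains so after a contraction, which
maps null sets to null sets in both directions. -/
lemma aemeasurable_comp_contract {b : Fin p → ℝ} (hb0 : ∀ i, 0 ≤ b i) (hb1 : ∀ i, b i ≤ 1)
    {c : ℝ} (hc : c < 1) {F : EuclideanSpace ℝ (Fin p) → ℝ≥0∞}
    (hF : AEMeasurable F (stdGaussian (EuclideanSpace ℝ (Fin p)))) :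
    AEMeasurable (fun x => F (contract b c x)) (stdGaussian (EuclideanSpace ℝ (Fin p))) := by
  have hac : (volume : Measure (EuclideanSpace ℝ (Fin p))) ≪
      stdGaussian (EuclideanSpace ℝ (Fin p)) := by
    rw [stdGaussian_eq_tilted]
    exact absolutelyContinuous_tilted integrable_exp_neg_norm_sq_div_two
  have hac' : stdGaussian (EuclideanSpace ℝ (Fin p)) ≪ volume := by
    rw [stdGaussian_eq_tilted]
    exact tilted_absolutelyContinuous _ _
  have hdet : LinearMap.det (contract b c) ≠ 0 := by
    rw [contract, det_diagScale]
    exact (Finset.prod_pos fun i _ => one_sub_mul_pos (hb0 i) (hb1 i) hc).ne'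
  have hq : Measure.QuasiMeasurePreserving (contract b c)
      (volume : Measure (EuclideanSpace ℝ (Fin p))) volume := by
    refine ⟨(continuous_contract b c).measurable, ?_⟩
    rw [Measure.map_linearMap_addHaar_eq_smul_addHaar _ hdet]
    exact Measure.smul_absolutelyContinuous
  exact ((hF.mono_ac hac).comp_quasiMeasurePreserving hq).mono_ac hac'

/-- The local error in terms of a majorant `τ` of `|δ|`. Since the density ratio makes the weighted
Gaussian average of `τ` along any contraction equal to that of `τ`, summing the pointwise domination
over `j` costs only the factor `∑ j, 15 / 2 * c ^ 2 * 3 / 2 = 9 / 2 * ω`. -/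
lemma setLIntegral_exp_sub_one_le (h : NormalForm b P t ν ω δ)
    {τ : EuclideanSpace ℝ (Fin p) → ℝ} (hτ0 : ∀ x, 0 ≤ τ x)
    (hτm : AEMeasurable τ (stdGaussian (EuclideanSpace ℝ (Fin p))))
    (hτ : ∀ x, √(diagQuad b x) ≤ ν⁻¹ * (2 * √P + √(2 * t)) → |δ x| ≤ τ x) :
    ∫⁻ x in {x | √(diagQuad b x) ≤ ν⁻¹ * (2 * √P + √(2 * t))},
      ENNReal.ofReal (Real.exp (δ x) - 1) ∂(stdGaussian (EuclideanSpace ℝ (Fin p))) ≤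
    ENNReal.ofReal (3 * (1 + 3 / 2 * ω)) *
      ∫⁻ x, ENNReal.ofReal (τ x) ∂(stdGaussian (EuclideanSpace ℝ (Fin p))) := by
  have hω := h.ω_nonneg
  have hω3 := h.ω_le_third
  set γ := stdGaussian (EuclideanSpace ℝ (Fin p)) with hγ
  set T : EuclideanSpace ℝ (Fin p) → ℝ≥0∞ := fun x => ENNReal.ofReal (τ x) with hT
  set I := ∫⁻ x, T x ∂γ with hI
  have hTm : AEMeasurable T γ := hτm.ennreal_ofReal
  set c : ℕ → ℝ := fun j => √(ω / 5 * (1 / 2) ^ j) with hc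
  have hc2 : ∀ j, c j ^ 2 = ω / 5 * (1 / 2) ^ j := fun j => Real.sq_sqrt (by positivity)
  have hc0 : ∀ j, 0 ≤ c j := fun j => Real.sqrt_nonneg _
  have hc3 : ∀ j, 2 * c j < 1 := by
    intro j
    have : ((1 : ℝ) / 2) ^ j ≤ 1 := pow_le_one₀ (by norm_num) (by norm_num)
    have := mul_le_mul hω3 this (by positivity) (by norm_num)
    nlinarith [hc2 j, hc0 j]
  set w : ℕ → EuclideanSpace ℝ (Fin p) → ℝ≥0∞ := fun j x =>
    ENNReal.ofReal (15 / 2 * c j ^ 2) *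
      (ENNReal.ofReal (contractWeight b (c j) x) * T (contract b (c j) x) +
        ENNReal.ofReal (1 / 2) * (ENNReal.ofReal (contractWeight b (2 * c j) x) *
          T (contract b (2 * c j) x))) with hw
  have hW : ∀ c', 0 ≤ c' → c' < 1 → ∀ x, 0 ≤ contractWeight b c' x := fun c' _ h1 x =>
    (Real.exp_pos _).le.trans (exp_le_contractWeight h.nonneg h.le_one h1 x)
  have hWm : ∀ c', c' < 1 → AEMeasurable
      (fun x => ENNReal.ofReal (contractWeight b c' x) * T (contract b c' x)) γ := fun c' h1 =>
    (continuous_contractWeight b c').measurable.ennreal_ofReal.aemeasurable.mul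
      (aemeasurable_comp_contract h.nonneg h.le_one h1 hTm)
  have hcl : ∀ j, c j < 1 := fun j => by linarith [hc3 j, hc0 j]
  have hwm : ∀ j, AEMeasurable (w j) γ := fun j =>
    ((hWm _ (hcl j)).add ((hWm _ (hc3 j)).const_mul _)).const_mul _
  have hwI : ∀ j, ∫⁻ x, w j x ∂γ = ENNReal.ofReal (9 / 4 * ω * (1 / 2) ^ j) * I := by
    intro j
    rw [lintegral_const_mul' _ _ ENNReal.ofReal_ne_top, lintegral_add_left' (hWm _ (hcl j)),
      lintegral_const_mul' _ _ ENNReal.ofReal_ne_top,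
      lintegral_contractWeight_mul h.nonneg h.le_one (hcl j),
      lintegral_contractWeight_mul h.nonneg h.le_one (hc3 j), ← hI]
    nth_rw 1 [← one_mul I]
    rw [← add_mul, ← mul_assoc, ← ENNReal.ofReal_one,
      ← ENNReal.ofReal_add zero_le_one (by norm_num), ← ENNReal.ofReal_mul (by positivity), hc2]
    congr 2; ring
  have hpt : ∀ x, √(diagQuad b x) ≤ ν⁻¹ * (2 * √P + √(2 * t)) →
      ENNReal.ofReal (Real.exp (δ x) - 1) ≤ ENNReal.ofReal 3 * T x + ∑' j, w j x := by
    intro x hx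
    obtain ⟨j, hj⟩ := h.exists_contract_bound hτ0 hτ hx
    refine le_trans ?_ (add_le_add_right (ENNReal.le_tsum j) _)
    have h1 := hW _ (hc0 j) (hcl j) x
    have h2 := hW _ (mul_nonneg zero_le_two (hc0 j)) (hc3 j) x
    have h3 := hτ0 (contract b (c j) x)
    have h4 := hτ0 (contract b (2 * c j) x)
    have h5 := hτ0 x
    rw [hw, hT]
    simp only
    rw [← ENNReal.ofReal_mul (by norm_num), ← ENNReal.ofReal_mul h1, ← ENNReal.ofReal_mul h2,
      ← ENNReal.ofReal_mul (by norm_num), ← ENNReal.ofReal_add (by positivity) (by positivity),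
      ← ENNReal.ofReal_mul (by positivity), ← ENNReal.ofReal_add (by positivity) (by positivity)]
    refine ENNReal.ofReal_le_ofReal ((hj (c j) rfl).trans (le_of_eq ?_))
    ring
  calc ∫⁻ x in {x | √(diagQuad b x) ≤ ν⁻¹ * (2 * √P + √(2 * t))},
        ENNReal.ofReal (Real.exp (δ x) - 1) ∂γ
      ≤ ∫⁻ x in {x | √(diagQuad b x) ≤ ν⁻¹ * (2 * √P + √(2 * t))},
          (ENNReal.ofReal 3 * T x + ∑' j, w j x) ∂γ :=
        setLIntegral_mono' (measurableSet_le (continuous_diagQuad b).measurable.sqrt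
          measurable_const) hpt
    _ ≤ ∫⁻ x, (ENNReal.ofReal 3 * T x + ∑' j, w j x) ∂γ := setLIntegral_le_lintegral _ _
    _ = ENNReal.ofReal 3 * I + ∑' j, ENNReal.ofReal (9 / 4 * ω * (1 / 2) ^ j) * I := by
        rw [lintegral_add_left' (hTm.const_mul _), lintegral_const_mul' _ _ ENNReal.ofReal_ne_top,
          lintegral_tsum hwm]
        simp_rw [hwI]
        rfl
    _ = _ := by
        have hs : Summable fun j : ℕ => 9 / 4 * ω * (1 / 2 : ℝ) ^ j :=
          summable_geometric_two.mul_left _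
        rw [ENNReal.tsum_mul_right, ← ENNReal.ofReal_tsum_of_nonneg (fun j => by positivity) hs,
          tsum_mul_left, tsum_geometric_two, ← add_mul,
          ← ENNReal.ofReal_add (by norm_num) (by positivity)]
        congr 2; ring

end NormalForm

/-! ### From tilted densities to total variation -/

lemma abs_integral_sub_integral_le_two {α : Type*} [MeasurableSpace α] {μ ν : Measure α}
    [IsProbabilityMeasure μ] [IsProbabilityMeasure ν] {g : α → ℝ} (hg1 : ∀ x, |g x| ≤ 1) :
    |(∫ x, g x ∂ν) - ∫ x, g x ∂μ| ≤ 2 := by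
  have h : ∀ (κ : Measure α) [IsProbabilityMeasure κ], |∫ x, g x ∂κ| ≤ 1 := by
    intro κ _
    have := norm_integral_le_of_norm_le_const (μ := κ) (f := g) (C := 1) (ae_of_all _ hg1)
    simpa using this
  calc _ ≤ |∫ x, g x ∂ν| + |∫ x, g x ∂μ| := abs_sub _ _
    _ ≤ 2 := by linarith [h ν, h μ]

lemma integral_abs_eq_two_mul {α : Type*} [MeasurableSpace α] {μ : Measure α} {φ : α → ℝ}
    (hφ : Integrable φ μ) (hφ0 : ∫ x, φ x ∂μ = 0) :
    ∫ x, |φ x| ∂μ = 2 * ∫ x, max (φ x) 0 ∂μ := by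
  have hi : Integrable (fun x => max (φ x) 0) μ := hφ.pos_part
  have h : ∫ x, |φ x| ∂μ = ∫ x, (2 * max (φ x) 0 - φ x) ∂μ := by
    refine integral_congr_ae (ae_of_all _ fun x => ?_)
    rcases le_total (φ x) 0 with h | h
    · simp only [abs_of_nonpos h, max_eq_right h]; ring
    · simp only [abs_of_nonneg h, max_eq_left h]; ring
  rw [h, integral_sub (hi.const_mul 2) hφ, integral_const_mul, hφ0, sub_zero]

/-- Total variation bound for a tilted probability measure. Dividing `exp δ` by the normalizing
constant `Z` shrinks the positive part of `exp δ - 1` if `1 ≤ Z`, and the negative part otherwise;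
since both parts of `exp δ / Z - 1` have the same mass, no factor `Z⁻¹` is lost. -/
lemma abs_integral_tilted_sub_integral_le {α : Type*} [MeasurableSpace α] {μ : Measure α}
    [IsProbabilityMeasure μ] {δ : α → ℝ} (hint : Integrable (fun x => Real.exp (δ x)) μ)
    {B : ℝ} (hB : 0 ≤ B)
    (h1 : ∫⁻ x, ENNReal.ofReal (Real.exp (δ x) - 1) ∂μ ≤ ENNReal.ofReal B)
    (h2 : ∫⁻ x, ENNReal.ofReal (1 - Real.exp (δ x)) ∂μ ≤ ENNReal.ofReal B)
    {g : α → ℝ} (hg : Measurable g) (hg1 : ∀ x, |g x| ≤ 1) :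
    |(∫ x, g x ∂(μ.tilted δ)) - ∫ x, g x ∂μ| ≤ 2 * B := by
  set Z := ∫ x, Real.exp (δ x) ∂μ with hZ
  have hZ0 : 0 < Z := integral_exp_pos hint
  have hpart : ∀ u : α → ℝ, Integrable u μ →
      ∫⁻ x, ENNReal.ofReal (u x) ∂μ ≤ ENNReal.ofReal B → ∫ x, max (u x) 0 ∂μ ≤ B := by
    intro u hu hle
    have hi : Integrable (fun x => max (u x) 0) μ := hu.pos_part
    rw [integral_eq_lintegral_of_nonneg_ae (f := fun x => max (u x) 0)
      (ae_of_all _ fun x => le_max_right _ _) hi.aestronglyMeasurable]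
    refine ENNReal.toReal_le_of_le_ofReal hB (le_trans (le_of_eq ?_) hle)
    refine lintegral_congr fun x => ?_
    rcases le_total (u x) 0 with h | h
    · rw [max_eq_right h, ENNReal.ofReal_of_nonpos h, ENNReal.ofReal_zero]
    · rw [max_eq_left h]
  have hip : Integrable (fun x => Real.exp (δ x) - 1) μ := hint.sub (integrable_const 1)
  have hin : Integrable (fun x => 1 - Real.exp (δ x)) μ := (integrable_const 1).sub hint
  have hp := hpart _ hip h1
  have hn := hpart _ hin h2
  set φ : α → ℝ := fun x => Real.exp (δ x) / Z - 1 with hφ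
  have hφi : Integrable φ μ := (hint.div_const Z).sub (integrable_const 1)
  have hφ0 : ∫ x, φ x ∂μ = 0 := by
    rw [hφ, integral_sub (hint.div_const Z) (integrable_const 1), integral_div, ← hZ,
      div_self hZ0.ne']
    simp
  have hgb : ∀ᵐ x ∂μ, ‖g x‖ ≤ 1 := ae_of_all _ hg1
  have hgi : Integrable g μ := Integrable.of_bound hg.aestronglyMeasurable 1 hgb
  have h3 : (∫ x, g x ∂(μ.tilted δ)) - ∫ x, g x ∂μ = ∫ x, φ x * g x ∂μ := by
    rw [integral_tilted, ← integral_sub ?_ hgi]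
    · refine integral_congr_ae (ae_of_all _ fun x => ?_)
      simp only [hφ, smul_eq_mul]; ring
    · exact (hint.div_const Z).mul_bdd hg.aestronglyMeasurable hgb
  have h4 : |∫ x, φ x * g x ∂μ| ≤ ∫ x, |φ x| ∂μ := by
    refine (abs_integral_le_integral_abs).trans (integral_mono_of_nonneg
      (ae_of_all _ fun x => abs_nonneg _) hφi.abs (ae_of_all _ fun x => ?_))
    simp only [abs_mul]
    exact mul_le_of_le_one_right (abs_nonneg _) (hg1 x)
  rw [h3]
  refine h4.trans ?_
  rcases le_total 1 Z with hZ1 | hZ1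
  · rw [integral_abs_eq_two_mul hφi hφ0]
    refine mul_le_mul_of_nonneg_left (le_trans (integral_mono hφi.pos_part
      hip.pos_part fun x => ?_) hp) zero_le_two
    exact max_le_max_right _ (sub_le_sub_right (div_le_self (Real.exp_pos _).le hZ1) _)
  · have hφn : Integrable (fun x => -φ x) μ := hφi.neg
    have h5 := integral_abs_eq_two_mul hφn (by rw [integral_neg, hφ0, neg_zero])
    simp only [abs_neg] at h5
    rw [h5]
    refine mul_le_mul_of_nonneg_left (le_trans (integral_mono hφn.pos_part
      hin.pos_part fun x => max_le_max_right _ ?_) hn) zero_le_two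
    have : Real.exp (δ x) ≤ Real.exp (δ x) / Z :=
      le_div_self (Real.exp_pos _).le hZ0 hZ1
    simp only [hφ]
    linarith

namespace NormalForm

variable {p : ℕ} {b : Fin p → ℝ} {P t ν ω : ℝ} {δ : EuclideanSpace ℝ (Fin p) → ℝ}

lemma measurableSet_local (b : Fin p → ℝ) (R : ℝ) : MeasurableSet {x | √(diagQuad b x) ≤ R} :=
  measurableSet_le (continuous_diagQuad b).measurable.sqrt measurable_const

lemma compl_local (b : Fin p → ℝ) (R : ℝ) :
    {x | √(diagQuad b x) ≤ R}ᶜ = {x | R < √(diagQuad b x)} := by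
  ext x; simp

lemma integrable_exp (h : NormalForm b P t ν ω δ) :
    Integrable (fun x => Real.exp (δ x)) (stdGaussian (EuclideanSpace ℝ (Fin p))) := by
  refine ⟨h.continuous.rexp.aestronglyMeasurable, ?_⟩
  rw [hasFiniteIntegral_iff_ofReal (ae_of_all _ fun x => (Real.exp_pos _).le),
    ← lintegral_add_compl _ (measurableSet_local _ _), compl_local]
  refine ENNReal.add_lt_top.2 ⟨?_, h.setLIntegral_compl_le.trans_lt ENNReal.ofReal_lt_top⟩
  refine lt_of_le_of_lt (le_trans (setLIntegral_mono' (measurableSet_local _ _) fun x hx => ?_)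
    (setLIntegral_le_lintegral _ _)) ((lintegral_exp_diagQuad_le h.nonneg h.le_one (μ := ω)
    (by linarith [h.ω_le_third])).trans_lt ENNReal.ofReal_lt_top)
  exact ENNReal.ofReal_le_ofReal (Real.exp_le_exp.2 ((le_abs_self _).trans (h.abs_le x hx)))

/-- A bound `2 d` for both parts of `exp δ - 1` on the local set yields the bound
`4 (ρ* + d)` on integrals against the tilted Gaussian measure. -/
lemma abs_integral_tilted_sub_le (h : NormalForm b P t ν ω δ) {d : ℝ} (hd : 0 ≤ d)
    (h1 : ∫⁻ x in {x | √(diagQuad b x) ≤ ν⁻¹ * (2 * √P + √(2 * t))},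
      ENNReal.ofReal (Real.exp (δ x) - 1) ∂(stdGaussian (EuclideanSpace ℝ (Fin p))) ≤
        ENNReal.ofReal (2 * d))
    (h2 : ∫⁻ x in {x | √(diagQuad b x) ≤ ν⁻¹ * (2 * √P + √(2 * t))},
      ENNReal.ofReal (1 - Real.exp (δ x)) ∂(stdGaussian (EuclideanSpace ℝ (Fin p))) ≤
        ENNReal.ofReal (2 * d))
    {g : EuclideanSpace ℝ (Fin p) → ℝ} (hg : Measurable g) (hg1 : ∀ x, |g x| ≤ 1) :
    |(∫ x, g x ∂((stdGaussian (EuclideanSpace ℝ (Fin p))).tilted δ)) -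
      ∫ x, g x ∂(stdGaussian (EuclideanSpace ℝ (Fin p)))| ≤
        4 * (4 * Real.exp (-t - P / 2) + d) := by
  have hprob := isProbabilityMeasure_tilted h.integrable_exp
  set e := Real.exp (-t - P / 2) with he
  have he0 : 0 < e := Real.exp_pos _
  -- If `e ≥ 1 / 8`, then `4 * (4 * e)` is at least the trivial bound `2`.
  rcases le_or_gt (1 / 8) e with h8 | h8
  · exact (abs_integral_sub_integral_le_two hg1).trans (by linarith)
  have htP : 2 ≤ t + P / 2 := by
    by_contra hcon
    have h3 : Real.exp (-2) ≤ e := Real.exp_le_exp.2 (by linarith)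
    have h4 : Real.exp 2 = Real.exp 1 ^ 2 := by rw [← Real.exp_nat_mul]; norm_num
    have h5 : Real.exp 1 ^ 2 ≤ 2.7182818286 ^ 2 :=
      pow_le_pow_left₀ (Real.exp_pos 1).le Real.exp_one_lt_d9.le 2
    have h6 : (1 / 8 : ℝ) ≤ Real.exp (-2) := by
      rw [Real.exp_neg, one_div]
      refine inv_anti₀ (Real.exp_pos _) ?_
      rw [h4]
      exact h5.trans (by norm_num)
    linarith
  have h3 := abs_integral_tilted_sub_integral_le h.integrable_exp (B := 2 * d + 8 * e)
    (by linarith) ?_ ?_ hg hg1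
  · linarith
  · rw [← lintegral_add_compl _ (measurableSet_local _ _), compl_local,
      ENNReal.ofReal_add (by linarith) (by linarith)]
    refine add_le_add h1 (le_trans (lintegral_mono fun x => ?_) (h.setLIntegral_compl_le.trans ?_))
    · exact ENNReal.ofReal_le_ofReal (by linarith)
    · refine ENNReal.ofReal_le_ofReal (mul_le_mul_of_nonneg_right ?_ he0.le)
      have : 8 / (t + P / 2) ≤ 4 := by
        rw [div_le_iff₀ (by linarith)]; linarith
      linarith
  · rw [← lintegral_add_compl _ (measurableSet_local _ _), compl_local,
      ENNReal.ofReal_add (by linarith) (by linarith)]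
    refine add_le_add h2 (le_trans (lintegral_mono (g := fun _ => 1) fun x => ?_) ?_)
    · rw [← ENNReal.ofReal_one]
      exact ENNReal.ofReal_le_ofReal (by linarith [Real.exp_pos (δ x)])
    · rw [setLIntegral_one]
      exact h.measure_compl_le.trans (ENNReal.ofReal_le_ofReal (by linarith))

lemma abs_integral_tilted_sub_le_diamond2 (h : NormalForm b P t ν ω δ)
    {g : EuclideanSpace ℝ (Fin p) → ℝ} (hg : Measurable g) (hg1 : ∀ x, |g x| ≤ 1) :
    |(∫ x, g x ∂((stdGaussian (EuclideanSpace ℝ (Fin p))).tilted δ)) -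
      ∫ x, g x ∂(stdGaussian (EuclideanSpace ℝ (Fin p)))| ≤
        4 * (4 * Real.exp (-t - P / 2) + 0.75 * ω * P / (1 - ω)) := by
  have hω := h.ω_nonneg
  have hP := h.dim_nonneg
  have hω1 : 0 < 1 - ω := by linarith [h.ω_le_third]
  have hd : 2 * (0.75 * ω * P / (1 - ω)) = 3 / 2 * (ω * P / (1 - ω)) := by ring
  refine h.abs_integral_tilted_sub_le (by positivity) ?_ ?_ hg hg1 <;> rw [hd] <;>
    refine le_trans (lintegral_mono fun x => ENNReal.ofReal_le_ofReal ?_)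
      h.setLIntegral_exp_abs_sub_one_le
  · exact sub_le_sub_right (Real.exp_le_exp.2 (le_abs_self _)) _
  · have h1 := Real.add_one_le_exp (δ x)
    have h2 := Real.add_one_le_exp |δ x|
    have h3 := neg_abs_le (δ x)
    linarith

lemma abs_integral_tilted_sub_le_diamond3 (h : NormalForm b P t ν ω δ)
    {τ : EuclideanSpace ℝ (Fin p) → ℝ} (hτ0 : ∀ x, 0 ≤ τ x)
    (hτi : Integrable τ (stdGaussian (EuclideanSpace ℝ (Fin p))))
    (hτ : ∀ x, √(diagQuad b x) ≤ ν⁻¹ * (2 * √P + √(2 * t)) → |δ x| ≤ τ x / 6)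
    {g : EuclideanSpace ℝ (Fin p) → ℝ} (hg : Measurable g) (hg1 : ∀ x, |g x| ≤ 1) :
    |(∫ x, g x ∂((stdGaussian (EuclideanSpace ℝ (Fin p))).tilted δ)) -
      ∫ x, g x ∂(stdGaussian (EuclideanSpace ℝ (Fin p)))| ≤
        4 * (4 * Real.exp (-t - P / 2) +
          (∫ x, τ x ∂(stdGaussian (EuclideanSpace ℝ (Fin p)))) / (4 * (1 - ω) ^ (3 / 2 : ℝ))) := by
  have hω := h.ω_nonneg
  have hω1 : 0 < 1 - ω := by linarith [h.ω_le_third]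
  set m := ∫ x, τ x ∂(stdGaussian (EuclideanSpace ℝ (Fin p))) with hm
  have hm0 : 0 ≤ m := integral_nonneg hτ0
  have hI : ∫⁻ x, ENNReal.ofReal (τ x / 6) ∂(stdGaussian (EuclideanSpace ℝ (Fin p))) =
      ENNReal.ofReal (m / 6) := by
    rw [← ofReal_integral_eq_lintegral_ofReal (hτi.div_const 6)
      (ae_of_all _ fun x => div_nonneg (hτ0 x) (by norm_num)), integral_div]
  have hpow : 0 < (1 - ω) ^ (3 / 2 : ℝ) := Real.rpow_pos_of_pos hω1 _
  have hbound : 3 * (1 + 3 / 2 * ω) * (m / 6) ≤ 2 * (m / (4 * (1 - ω) ^ (3 / 2 : ℝ))) := by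
    have h1 := mul_le_mul_of_nonneg_right (one_add_le_rpow_neg hω (by linarith)) hm0
    have h2 : 2 * (m / (4 * (1 - ω) ^ (3 / 2 : ℝ))) = ((1 - ω) ^ (3 / 2 : ℝ))⁻¹ * m / 2 := by
      field_simp; ring
    rw [h2]; linarith
  refine h.abs_integral_tilted_sub_le (by positivity) ?_ ?_ hg hg1
  · refine (h.setLIntegral_exp_sub_one_le (τ := fun x => τ x / 6)
      (fun x => div_nonneg (hτ0 x) (by norm_num)) (hτi.aemeasurable.div_const 6) hτ).trans ?_
    rw [hI, ← ENNReal.ofReal_mul (by positivity)]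
    exact ENNReal.ofReal_le_ofReal hbound
  · refine le_trans (setLIntegral_mono' (measurableSet_local _ _) fun x hx =>
      ENNReal.ofReal_le_ofReal (?_ : _ ≤ τ x / 6)) ((setLIntegral_le_lintegral _ _).trans ?_)
    · have h1 := Real.add_one_le_exp (δ x)
      have h3 := neg_abs_le (δ x)
      linarith [hτ x hx]
    · rw [hI]
      refine ENNReal.ofReal_le_ofReal (le_trans ?_ hbound)
      nlinarith

end NormalForm

/-! ### Changes of variables and simultaneous diagonalization -/

lemma ofLp_toEuclideanLin (M : Matrix (Fin p) (Fin p) ℝ) (v : EuclideanSpace ℝ (Fin p)) :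
    (Matrix.toEuclideanLin M v).ofLp = M *ᵥ v.ofLp := rfl

lemma quad_eq_dotProduct (A : Matrix (Fin p) (Fin p) ℝ) (u : EuclideanSpace ℝ (Fin p)) :
    quad A u = u.ofLp ⬝ᵥ A *ᵥ u.ofLp := by
  rw [quad, EuclideanSpace.inner_eq_star_dotProduct]
  simp

lemma quad_toEuclideanLin (A T : Matrix (Fin p) (Fin p) ℝ) (x : EuclideanSpace ℝ (Fin p)) :
    quad A (Matrix.toEuclideanLin T x) = quad (Tᵀ * A * T) x := by
  rw [quad_eq_dotProduct, quad_eq_dotProduct, ofLp_toEuclideanLin,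
    ← Matrix.mulVec_mulVec, ← Matrix.mulVec_mulVec, Matrix.dotProduct_mulVec x.ofLp,
    Matrix.vecMul_transpose]

lemma quad_one (x : EuclideanSpace ℝ (Fin p)) : quad 1 x = ‖x‖ ^ 2 := by
  rw [quad_eq_dotProduct, Matrix.one_mulVec, EuclideanSpace.real_norm_sq_eq]
  simp [dotProduct, sq]

lemma quad_diagonal (b : Fin p → ℝ) (x : EuclideanSpace ℝ (Fin p)) :
    quad (Matrix.diagonal b) x = diagQuad b x := by
  rw [quad_eq_dotProduct, diagQuad]
  simp only [dotProduct, Matrix.mulVec_diagonal]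
  exact Finset.sum_congr rfl fun i _ => by ring

lemma norm_toEuclideanLin_sq {D : Matrix (Fin p) (Fin p) ℝ} (hD : D.IsSymm)
    (u : EuclideanSpace ℝ (Fin p)) : ‖Matrix.toEuclideanLin D u‖ ^ 2 = quad (D ^ 2) u := by
  rw [← quad_one, quad_toEuclideanLin, hD.eq, mul_one, sq]

/-- Simultaneous diagonalization: `T = H^(-1/2) U`, where `U` diagonalizes `H^(-1/2) V H^(-1/2)`. -/
lemma exists_simultaneous_diagonalization {H V : Matrix (Fin p) (Fin p) ℝ} (hH : H.PosDef)
    (hV : V.IsSymm) : ∃ (T : Matrix (Fin p) (Fin p) ℝ) (b : Fin p → ℝ),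
      Tᵀ * H * T = 1 ∧ Tᵀ * V * T = Matrix.diagonal b := by
  open scoped MatrixOrder in
  obtain ⟨Q, hQs, hQ⟩ : ∃ Q : Matrix (Fin p) (Fin p) ℝ, Qᵀ = Q ∧ Q * Q = H⁻¹ := by
    refine ⟨CFC.sqrt H⁻¹, ?_, CFC.sqrt_mul_sqrt_self _ hH.inv.posSemidef.nonneg⟩
    have := (Matrix.nonneg_iff_posSemidef.1 (CFC.sqrt_nonneg H⁻¹)).isHermitian
    rwa [Matrix.IsHermitian, Matrix.conjTranspose_eq_transpose_of_trivial] at this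
  have hdet : IsUnit H.det := isUnit_iff_ne_zero.2 hH.det_pos.ne'
  have hQHQ : Q * H * Q = 1 := by
    rw [mul_eq_one_comm, ← mul_assoc, hQ, Matrix.nonsing_inv_mul _ hdet]
  have hB : (Q * V * Q).IsHermitian := by
    rw [Matrix.IsHermitian, Matrix.conjTranspose_eq_transpose_of_trivial,
      Matrix.transpose_mul, Matrix.transpose_mul, hQs, hV.eq, mul_assoc]
  set U : Matrix (Fin p) (Fin p) ℝ := hB.eigenvectorUnitary.1 with hU
  have hUU : Uᵀ * U = 1 := by
    have := Unitary.coe_star_mul_self hB.eigenvectorUnitary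
    rwa [Matrix.star_eq_conjTranspose, Matrix.conjTranspose_eq_transpose_of_trivial] at this
  have hspec := hB.spectral_theorem
  refine ⟨Q * U, hB.eigenvalues, ?_, ?_⟩
  · calc (Q * U)ᵀ * H * (Q * U) = Uᵀ * (Q * H * Q) * U := by
          rw [Matrix.transpose_mul, hQs]; simp only [mul_assoc]
      _ = 1 := by rw [hQHQ, mul_one, hUU]
  · have h1 : Q * V * Q = U * Matrix.diagonal hB.eigenvalues * Uᵀ := by
      conv_lhs => rw [hspec, Unitary.conjStarAlgAut_apply]
      rw [Matrix.star_eq_conjTranspose, Matrix.conjTranspose_eq_transpose_of_trivial]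
      rfl
    calc (Q * U)ᵀ * V * (Q * U) = Uᵀ * (Q * V * Q) * U := by
          rw [Matrix.transpose_mul, hQs]; simp only [mul_assoc]
      _ = (Uᵀ * U) * Matrix.diagonal hB.eigenvalues * (Uᵀ * U) := by
          refine (congrArg (fun M => Uᵀ * M * U) h1).trans ?_
          simp only [mul_assoc]
      _ = _ := by rw [hUU, one_mul, mul_one]

/-- The definition of the Gaussian measure uses the symmetric square root of `S`; any factor `T`
with `T * Tᵀ = S` gives the same measure. -/
lemma multivariateGaussian_eq_map {S T : Matrix (Fin p) (Fin p) ℝ} (hT : T * Tᵀ = S)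
    (m : EuclideanSpace ℝ (Fin p)) :
    multivariateGaussian m S =
      (stdGaussian (EuclideanSpace ℝ (Fin p))).map fun x => m + Matrix.toEuclideanLin T x := by
  have hS : S.PosSemidef := by
    rw [← hT, ← Matrix.conjTranspose_eq_transpose_of_trivial]
    exact Matrix.posSemidef_self_mul_conjTranspose T
  have hc : Continuous (Matrix.toEuclideanLin T) := LinearMap.continuous_of_finiteDimensional _
  have hm : Measurable fun x => m + Matrix.toEuclideanLin T x := by fun_prop
  have : IsProbabilityMeasure ((stdGaussian (EuclideanSpace ℝ (Fin p))).map
      fun x => m + Matrix.toEuclideanLin T x) := Measure.isProbabilityMeasure_map hm.aemeasurable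
  apply Measure.ext_of_charFun
  ext s
  rw [charFun_multivariateGaussian hS, charFun_apply, integral_map hm.aemeasurable (by fun_prop)]
  have h1 : ∀ x : EuclideanSpace ℝ (Fin p),
      inner ℝ (m + Matrix.toEuclideanLin T x) s =
        inner ℝ m s + inner ℝ x (Matrix.toEuclideanLin Tᵀ s) := by
    intro x
    rw [inner_add_left, EuclideanSpace.inner_eq_star_dotProduct (Matrix.toEuclideanLin T x),
      EuclideanSpace.inner_eq_star_dotProduct x]
    simp only [star_trivial, ofLp_toEuclideanLin]
    rw [Matrix.dotProduct_mulVec, Matrix.mulVec_transpose]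
  have h2 : ∀ x : EuclideanSpace ℝ (Fin p),
      Complex.exp ((inner ℝ (m + Matrix.toEuclideanLin T x) s : ℝ) * Complex.I) =
        Complex.exp ((inner ℝ m s : ℝ) * Complex.I) *
          Complex.exp ((inner ℝ x (Matrix.toEuclideanLin Tᵀ s) : ℝ) * Complex.I) := by
    intro x
    rw [h1, ← Complex.exp_add]
    push_cast
    ring_nf
  simp_rw [h2]
  rw [integral_const_mul, ← charFun_apply, charFun_stdGaussian, ← Complex.exp_add]
  have h3 : ‖Matrix.toEuclideanLin Tᵀ s‖ ^ 2 = s.ofLp ⬝ᵥ S *ᵥ s.ofLp := by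
    rw [← quad_one, quad_toEuclideanLin, mul_one, Matrix.transpose_transpose, hT,
      quad_eq_dotProduct]
  have h4 : ((‖Matrix.toEuclideanLin Tᵀ s‖ : ℂ)) ^ 2 = ((s.ofLp ⬝ᵥ S *ᵥ s.ofLp : ℝ) : ℂ) := by
    rw [← h3]; push_cast; rfl
  rw [h4, real_inner_comm]
  congr 1
  ring

lemma tilted_map_of_measurableEmbedding {α β : Type*} [MeasurableSpace α] [MeasurableSpace β]
    {μ : Measure α} {Φ : α → β} (hΦ : MeasurableEmbedding Φ) (f : β → ℝ) :
    (μ.map Φ).tilted f = (μ.tilted (f ∘ Φ)).map Φ := by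
  ext s hs
  rw [tilted_apply' _ _ hs, hΦ.map_apply, tilted_apply' _ _ (hΦ.measurable hs),
    hΦ.restrict_map, hΦ.lintegral_map, hΦ.integral_map]
  rfl

lemma tilted_smul_measure {α : Type*} [MeasurableSpace α] {μ : Measure α} {k : ℝ≥0∞}
    (hk0 : k ≠ 0) (hk : k ≠ ∞) (f : α → ℝ) : (k • μ).tilted f = μ.tilted f := by
  ext s hs
  rw [tilted_apply' _ _ hs, tilted_apply' _ _ hs, integral_smul_measure, Measure.restrict_smul,
    lintegral_smul_measure, smul_eq_mul, ← lintegral_const_mul' _ _ hk]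
  refine lintegral_congr fun x => ?_
  have hk1 : 0 < k.toReal := ENNReal.toReal_pos hk0 hk
  nth_rw 1 [← ENNReal.ofReal_toReal hk]
  rw [← ENNReal.ofReal_mul hk1.le]
  congr 1
  rw [smul_eq_mul, ← mul_div_assoc, mul_div_mul_left _ _ hk1.ne']

lemma tilted_sub_const {α : Type*} [MeasurableSpace α] {μ : Measure α} (f : α → ℝ) (c : ℝ) :
    μ.tilted (fun x => f x - c) = μ.tilted f := by
  simp only [Measure.tilted, Real.exp_sub, integral_div]
  simp only [div_div_div_cancel_right₀ (Real.exp_pos c).ne']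

/-! ### Reduction to normal form -/

lemma abs_delta3_le_omega {f : EuclideanSpace ℝ (Fin p) → ℝ} {x u : EuclideanSpace ℝ (Fin p)}
    {DV : Matrix (Fin p) (Fin p) ℝ} {ν t : ℝ} (hω : omega f x DV ν t ≠ ∞)
    (hu : u ∈ localSet f x DV ν t) :
    |delta3 f x u| ≤ (omega f x DV ν t).toReal * ‖Matrix.toEuclideanLin DV u‖ ^ 2 / 2 := by
  have h1 : ENNReal.ofReal |delta3 f x u| / ENNReal.ofReal (‖Matrix.toEuclideanLin DV u‖ ^ 2 / 2)
      ≤ omega f x DV ν t :=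
    le_iSup₂ (f := fun u (_ : u ∈ localSet f x DV ν t) => ENNReal.ofReal |delta3 f x u| /
      ENNReal.ofReal (‖Matrix.toEuclideanLin DV u‖ ^ 2 / 2)) u hu
  rw [ENNReal.div_le_iff_le_mul (Or.inr hω) (Or.inl ENNReal.ofReal_ne_top)] at h1
  nth_rw 1 [← ENNReal.ofReal_toReal hω] at h1
  rw [← ENNReal.ofReal_mul ENNReal.toReal_nonneg,
    ENNReal.ofReal_le_ofReal_iff (by positivity)] at h1
  linarith

lemma quad_sub (A B : Matrix (Fin p) (Fin p) ℝ) (u : EuclideanSpace ℝ (Fin p)) :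
    quad (A - B) u = quad A u - quad B u := by
  rw [quad, map_sub, LinearMap.sub_apply, inner_sub_left, quad, quad]

lemma diagQuad_single (b : Fin p → ℝ) (i : Fin p) :
    diagQuad b (EuclideanSpace.single i 1) = b i := by
  rw [diagQuad, Finset.sum_eq_single i] <;> simp +contextual

/-- By homogeneity a function that dominates `6 |δ₃|` on the local set, a neighbourhood of the
origin, is nonnegative everywhere. -/
lemma SmoothCond3.nonneg {f τ₃ : EuclideanSpace ℝ (Fin p) → ℝ} {x : EuclideanSpace ℝ (Fin p)}
    {DV : Matrix (Fin p) (Fin p) ℝ} {ν t : ℝ} (h : SmoothCond3 f x DV ν t τ₃)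
    (hR : 0 < ν⁻¹ * radius f x DV t) (u : EuclideanSpace ℝ (Fin p)) : 0 ≤ τ₃ u := by
  set N := ‖Matrix.toEuclideanLin DV u‖ with hN
  set s := ν⁻¹ * radius f x DV t / (N + 1) with hs
  have hN0 : 0 ≤ N := norm_nonneg _
  have hs0 : 0 < s := by positivity
  have hmem : s • u ∈ localSet f x DV ν t := by
    change ‖Matrix.toEuclideanLin DV (s • u)‖ ≤ ν⁻¹ * radius f x DV t
    rw [map_smul, norm_smul, Real.norm_of_nonneg hs0.le, hs, div_mul_eq_mul_div,
      div_le_iff₀ (by positivity)]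
    nlinarith
  have h1 := (abs_nonneg _).trans (h.bound _ hmem)
  rw [h.homogeneous s u hs0] at h1
  have h2 : 0 ≤ s ^ 3 * τ₃ u := by linarith
  exact nonneg_of_mul_nonneg_right h2 (by positivity)

/-- The passage to normal form: a linear change of variables `T` turns `D_G²` into the identity and
`D_V²` into a diagonal matrix. -/
lemma exists_normalForm {f : EuclideanSpace ℝ (Fin p) → ℝ} {xstar : EuclideanSpace ℝ (Fin p)}
    {DV : Matrix (Fin p) (Fin p) ℝ} {ν t : ℝ} (hν0 : 0 < ν) (ht : 0 < t)
    (hmode : IsMaxOn f Set.univ xstar) (hDG : (DG2 f xstar).PosDef)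
    (hstruct : StructCond f xstar DV)
    (hω : omega f xstar DV ν t ≤ ENNReal.ofReal (1 - ν))
    (hν1 : ν < 1) (hω3 : omega f xstar DV ν t ≤ 1 / 3)
    (hωp : (omega f xstar DV ν t).toReal * effDim f xstar DV ≤ 2 / 3) :
    ∃ (T : Matrix (Fin p) (Fin p) ℝ) (b : Fin p → ℝ),
      T * Tᵀ = (DG2 f xstar)⁻¹ ∧ LinearMap.det (Matrix.toEuclideanLin T) ≠ 0 ∧
      (∀ x, √(diagQuad b x) = ‖Matrix.toEuclideanLin DV (Matrix.toEuclideanLin T x)‖) ∧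
      (∀ x, f (xstar + Matrix.toEuclideanLin T x) =
        (-‖x‖ ^ 2 / 2 + delta3 f xstar (Matrix.toEuclideanLin T x)) + f xstar) ∧
      NormalForm b (effDim f xstar DV) t ν (omega f xstar DV ν t).toReal
        (fun x => delta3 f xstar (Matrix.toEuclideanLin T x)) := by
  have hDV2 : (DV ^ 2).IsSymm := hstruct.isSymm.pow 2
  obtain ⟨T, b, hT1, hTb⟩ := exists_simultaneous_diagonalization hDG hDV2
  set H := DG2 f xstar with hH
  have hdetH : IsUnit H.det := isUnit_iff_ne_zero.2 hDG.det_pos.ne'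
  have hHTT : H * (T * Tᵀ) = 1 := by
    have h1 : T * (Tᵀ * H) = 1 := by rw [mul_eq_one_comm, hT1]
    rw [mul_eq_one_comm, mul_assoc, h1]
  have hTT : T * Tᵀ = H⁻¹ := (Matrix.inv_eq_right_inv hHTT).symm
  have hdet : T.det ≠ 0 := by
    intro h0
    have := congrArg Matrix.det hT1
    rw [Matrix.det_mul, h0, mul_zero, Matrix.det_one] at this
    exact zero_ne_one this
  have hquadH : ∀ x, quad H (Matrix.toEuclideanLin T x) = ‖x‖ ^ 2 := fun x => by
    rw [quad_toEuclideanLin, hT1, quad_one]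
  have hquadV : ∀ x, quad (DV ^ 2) (Matrix.toEuclideanLin T x) = diagQuad b x := fun x => by
    rw [quad_toEuclideanLin, hTb, quad_diagonal]
  have hnorm : ∀ x, ‖Matrix.toEuclideanLin DV (Matrix.toEuclideanLin T x)‖ ^ 2 = diagQuad b x :=
    fun x => by rw [norm_toEuclideanLin_sq hstruct.isSymm, hquadV]
  have hsqrt : ∀ x,
      √(diagQuad b x) = ‖Matrix.toEuclideanLin DV (Matrix.toEuclideanLin T x)‖ := fun x => by
    rw [← hnorm, Real.sqrt_sq (norm_nonneg _)]
  have hgrad : fderiv ℝ f xstar = 0 :=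
    (hmode.isLocalMax Filter.univ_mem).fderiv_eq_zero
  have hdelta : ∀ x, delta3 f xstar (Matrix.toEuclideanLin T x) =
      f (xstar + Matrix.toEuclideanLin T x) - f xstar + ‖x‖ ^ 2 / 2 := fun x => by
    rw [delta3, hgrad, ← hH, hquadH]
    simp
  have hωtop : omega f xstar DV ν t ≠ ∞ := ne_top_of_le_ne_top ENNReal.ofReal_ne_top hω
  refine ⟨T, b, hTT, ?_, hsqrt, fun x => by rw [hdelta]; ring, ?_⟩
  · rwa [Matrix.toEuclideanLin_eq_toLin_orthonormal, LinearMap.det_toLin]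
  refine ⟨fun i => ?_, fun i => ?_, ?_, ?_, ?_, ht, hν0, ENNReal.toReal_nonneg, ?_, ?_, hωp, ?_⟩
  · have := diagQuad_single b i
    rw [← this, ← hnorm]
    positivity
  · have h1 : diagQuad b (EuclideanSpace.single i 1) ≤ 1 := by
      have h2 : quad (H - DV ^ 2) (Matrix.toEuclideanLin T (EuclideanSpace.single i 1)) =
          1 - diagQuad b (EuclideanSpace.single i 1) := by
        rw [quad_sub, hquadH, hquadV]
        simp
      have h3 : 0 ≤ quad (H - DV ^ 2) (Matrix.toEuclideanLin T (EuclideanSpace.single i 1)) := by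
        rw [quad_eq_dotProduct]
        simpa using hstruct.le.dotProduct_mulVec_nonneg
          (Matrix.toEuclideanLin T (EuclideanSpace.single i 1)).ofLp
      linarith
    rwa [diagQuad_single] at h1
  · rw [effDim, ← hH, ← hTT, ← mul_assoc, Matrix.trace_mul_comm, ← mul_assoc, hTb,
      Matrix.trace_diagonal]
  · rw [map_zero, delta3, quad]
    simp
  · have h1 := (hstruct.concave.comp_linearMap (Matrix.toEuclideanLin T)).add_const (-f xstar)
    rw [Set.preimage_univ] at h1
    refine h1.congr fun x _ => ?_
    simp only [Pi.add_apply, Function.comp_apply]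
    rw [hdelta, ← hH, hquadH, hquadV]
    ring
  · have := ENNReal.toReal_mono ENNReal.ofReal_ne_top hω
    rwa [ENNReal.toReal_ofReal (by linarith)] at this
  · have := ENNReal.toReal_mono (by norm_num) hω3
    simpa using this
  · intro x hx
    rw [hsqrt] at hx
    rw [← hnorm]
    exact abs_delta3_le_omega hωtop hx

/-- The measure `Pf f` is the image, under an affine map, of a tilted standard Gaussian. -/
lemma Pf_eq_map {f δ : EuclideanSpace ℝ (Fin p) → ℝ} {m : EuclideanSpace ℝ (Fin p)}
    {T : EuclideanSpace ℝ (Fin p) →ₗ[ℝ] EuclideanSpace ℝ (Fin p)} (hT : LinearMap.det T ≠ 0)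
    (hf : ∀ x, f (m + T x) = (-‖x‖ ^ 2 / 2 + δ x) + f m) :
    Pf f = ((stdGaussian (EuclideanSpace ℝ (Fin p))).tilted δ).map fun x => m + T x := by
  have hTm := measurableEmbedding_of_det_ne_zero hT
  have hΦ : MeasurableEmbedding fun x => m + T x := (measurableEmbedding_addLeft m).comp hTm
  have hvol : (volume : Measure (EuclideanSpace ℝ (Fin p))).map (fun x => m + T x) =
      ENNReal.ofReal |(LinearMap.det T)⁻¹| • volume := by
    rw [show (fun x => m + T x) = (m + ·) ∘ T from rfl,
      ← Measure.map_map (measurable_const_add m) hTm.measurable,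
      Measure.map_linearMap_addHaar_eq_smul_addHaar _ hT, Measure.map_smul, map_add_left_eq_self]
  have hk : ENNReal.ofReal |(LinearMap.det T)⁻¹| ≠ 0 := by
    simpa using hT
  rw [Pf, ← tilted_smul_measure hk ENNReal.ofReal_ne_top, ← hvol,
    tilted_map_of_measurableEmbedding hΦ, stdGaussian_eq_tilted,
    tilted_tilted integrable_exp_neg_norm_sq_div_two,
    ← tilted_sub_const _ (f m)]
  congr 2
  ext x
  simp [hf]

end Laplace

end

open Laplace

theorem mainTheorem1 {p : ℕ} (f : EuclideanSpace ℝ (Fin p) → ℝ)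
    (xstar : EuclideanSpace ℝ (Fin p)) (DV : Matrix (Fin p) (Fin p) ℝ) (ν t : ℝ)
    (hν0 : 0 < ν) (hν1 : ν < 1) (ht : 0 < t)
    (hf : ContDiffAt ℝ 2 f xstar)
    (hmode : IsMaxOn f Set.univ xstar)
    (hDG : (Laplace.DG2 f xstar).PosDef)
    (hstruct : Laplace.StructCond f xstar DV)
    (hω : Laplace.omega f xstar DV ν t ≤ ENNReal.ofReal (1 - ν))
    (hω3 : Laplace.omega f xstar DV ν t ≤ 1 / 3)
    (hωp : (Laplace.omega f xstar DV ν t).toReal * Laplace.effDim f xstar DV ≤ 2 / 3) :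
    IsProbabilityMeasure (Laplace.Pf f) ∧
    (∀ d : ℝ,
      (d = Laplace.diamond2 f xstar DV ν t ∨
        ∃ τ₃ : EuclideanSpace ℝ (Fin p) → ℝ,
          Laplace.SmoothCond3 f xstar DV ν t τ₃ ∧
          Integrable τ₃ (multivariateGaussian 0 (Laplace.DG2 f xstar)⁻¹) ∧
          d = Laplace.diamond3 f xstar DV ν t τ₃) →
      (∀ g : EuclideanSpace ℝ (Fin p) → ℝ, Measurable g → (∀ u, |g u| ≤ 1) →
        |(∫ y, g (y - xstar) ∂(Laplace.Pf f)) -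
            ∫ u, g u ∂(multivariateGaussian 0 (Laplace.DG2 f xstar)⁻¹)| ≤
          4 * (Laplace.rhoStar f xstar DV t + d)) ∧
      (∀ A : Set (EuclideanSpace ℝ (Fin p)), MeasurableSet A →
        |(Laplace.Pf f).real A -
            (multivariateGaussian xstar (Laplace.DG2 f xstar)⁻¹).real A| ≤
          2 * (Laplace.rhoStar f xstar DV t + d))) := by
  obtain ⟨T, b, hTT, hdet, hsqrt, hfT, hNF⟩ :=
    exists_normalForm hν0 ht hmode hDG hstruct hω hν1 hω3 hωp
  set L := Matrix.toEuclideanLin T with hL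
  set γ := stdGaussian (EuclideanSpace ℝ (Fin p)) with hγ
  set δ : EuclideanSpace ℝ (Fin p) → ℝ := fun x => delta3 f xstar (L x) with hδ
  have hLm : MeasurableEmbedding L := measurableEmbedding_of_det_ne_zero hdet
  have hΦ : ∀ m : EuclideanSpace ℝ (Fin p), MeasurableEmbedding fun x => m + L x :=
    fun m => (measurableEmbedding_addLeft m).comp hLm
  have hPf : Pf f = (γ.tilted δ).map fun x => xstar + L x := Pf_eq_map hdet hfT
  have hG : ∀ m, multivariateGaussian m (DG2 f xstar)⁻¹ = γ.map fun x => m + L x :=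
    fun m => multivariateGaussian_eq_map hTT m
  have hprob : IsProbabilityMeasure (γ.tilted δ) := isProbabilityMeasure_tilted hNF.integrable_exp
  refine ⟨hPf ▸ Measure.isProbabilityMeasure_map (hΦ xstar).measurable.aemeasurable,
    fun d hd => ?_⟩
  have key : ∀ g : EuclideanSpace ℝ (Fin p) → ℝ, Measurable g → (∀ u, |g u| ≤ 1) →
      |∫ x, g x ∂(γ.tilted δ) - ∫ x, g x ∂γ| ≤ 4 * (rhoStar f xstar DV t + d) := by
    intro g hg hg1
    rcases hd with rfl | ⟨τ₃, hτ, hτi, rfl⟩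
    · exact hNF.abs_integral_tilted_sub_le_diamond2 hg hg1
    · have hloc : ∀ x, √(diagQuad b x) ≤
          ν⁻¹ * (2 * √(effDim f xstar DV) + √(2 * t)) → L x ∈ localSet f xstar DV ν t := by
        intro x hx
        rw [hsqrt] at hx
        exact hx
      have hR : 0 < ν⁻¹ * radius f xstar DV t := mul_pos (inv_pos.2 hν0) hNF.radius_pos
      rw [hG] at hτi
      rw [diamond3, hG, (hΦ 0).integral_map]
      rw [(hΦ 0).integrable_map_iff] at hτi
      simp only [zero_add] at hτi ⊢
      exact hNF.abs_integral_tilted_sub_le_diamond3 (τ := fun x => τ₃ (L x))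
        (fun x => hτ.nonneg hR _) hτi (fun x hx => hτ.bound _ (hloc x hx)) hg hg1
  have hbound : ∀ g : EuclideanSpace ℝ (Fin p) → ℝ, Measurable g → (∀ u, |g u| ≤ 1) →
      |(∫ y, g (y - xstar) ∂(Pf f)) - ∫ u, g u ∂(multivariateGaussian 0 (DG2 f xstar)⁻¹)| ≤
        4 * (rhoStar f xstar DV t + d) := by
    intro g hg hg1
    rw [hPf, hG, (hΦ xstar).integral_map, (hΦ 0).integral_map]
    simp only [add_sub_cancel_left, zero_add]
    exact key (fun x => g (L x)) (hg.comp hLm.measurable) fun x => hg1 _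
  refine ⟨hbound, fun A hA => ?_⟩
  -- The function `2 * 1_A - 1` takes values in `{-1, 1}`, which saves the factor two.
  set B : Set (EuclideanSpace ℝ (Fin p)) := (fun x => xstar + L x) ⁻¹' A with hB
  have hBm : MeasurableSet B := (hΦ xstar).measurable hA
  have h1 := key (fun x => 2 * B.indicator 1 x - 1)
    (((measurable_one.indicator hBm).const_mul 2).sub_const 1) fun x => by
      by_cases hx : x ∈ B <;> simp [hx]; norm_num
  have h2 : ∀ (μ : Measure (EuclideanSpace ℝ (Fin p))) [IsProbabilityMeasure μ],
      ∫ x, (2 * B.indicator (1 : EuclideanSpace ℝ (Fin p) → ℝ) x - 1) ∂μ = 2 * μ.real B - 1 := by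
    intro μ _
    rw [integral_sub (((integrable_const 1).indicator hBm).const_mul 2) (integrable_const 1),
      integral_const_mul, integral_indicator_one hBm]
    simp
  rw [h2, h2] at h1
  rw [hPf, hG, map_measureReal_apply (hΦ xstar).measurable hA,
    map_measureReal_apply (hΦ xstar).measurable hA, ← hB]
  rw [show 2 * (γ.tilted δ).real B - 1 - (2 * γ.real B - 1) =
    2 * ((γ.tilted δ).real B - γ.real B) by ring, abs_mul, abs_two] at h1
  linarith
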